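/- Let $N\ge 0$ (the truncation $n^{\max}$), let $|0\rangle,\dots,|N\rangle$ be the standard orthonormal basis of $\mathbb C^{N+1}$, let $\mathbf a$ be the truncated annihilation operator ($\mathbf a|0\rangle=0$, $\mathbf a|n\rangle=\sqrt n\,|n-1\rangle$ for $1\le n\le N$), and let $\mathbf N=\mathrm{diag}(0,1,\dots,N)$. Let $\mathcal X$ be the set of density matrices on $\mathbb C^{N+1}$ (Hermitian, positive semidefinite, trace one). For $\alpha\in\mathbb C$ put $D_\alpha=e^{\alpha\mathbf a^\dagger-\alpha^*\mathbf a}$ and $\mathbb D_\alpha(\rho)=D_\alpha\rho D_\alpha^\dagger$. For real parameters $\varphi_0,\vartheta$ put $M_g=\cos(\varphi_0+\vartheta\mathbf N)$, $M_e=\sin(\varphi_0+\vartheta\mathbf N)$; assume that $M_g$ and $M_e$ are invertible and that the spectra of $M_g^\dagger M_g$ and of $M_e^\dagger M_e$ are not degenerate (all eigenvalues are simple). For $s\in\{g,e\}$ put $\mathbb M_s(\rho)=M_s\rho M_s^\dagger/\mathrm{Tr}(M_s\rho M_s^\dagger)$, and let $\mathbb K_\alpha(\rho)=M_gD_\alpha\rho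 D_\alpha^\dagger M_g^\dagger+M_eD_\alpha\rho D_\alpha^\dagger M_e^\dagger$. Let $d\ge1$ be the delay. For $\chi=(\rho,\beta_1,\dots,\beta_d)\in\mathcal X\times\mathbb C^d$ put $$\rho^{\mathrm{pred}}(\chi)=\mathbb K_{\beta_1}\circ\cdots\circ\mathbb K_{\beta_d}(\rho),\qquad \rho^{\mathrm{pred}}_s(\chi)=\mathbb K_{\beta_1}\circ\cdots\circ\mathbb K_{\beta_{d-1}}\big(M_sD_{\beta_d}\rho D_{\beta_d}^\dagger M_s^\dagger\big),\quad s\in\{g,e\}.$$ Fix a target Fock state $\bar\rho=|\bar n\rangle\langle\bar n|$ with $\bar n\in\{0,\dots,N\}$, and $\bar\alpha>0$. For $\epsilon,\eta>0$, a feedback law is a function $\chi\mapsto\alpha(\chi)\in\mathbb C$ such that, for every $\chi\in\mathcal X\times\mathbb C^d$, $\alpha(\chi)=\epsilon\,\mathrm{Tr}\big(\bar\rho\,[\rho^{\mathrm{pred}}(\chi),\mathbf a]\big)$ if $\mathrm{Tr}(\bar\rho\,\rho^{\mathrm{pred}}(\chi))\ge\eta$, and $\alpha(\chi)$ is a maximiser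 over $\{|\alpha|\le\bar\alpha\}$ of $\mathrm{Tr}\big(\bar\rho\,\mathbb D_\alpha(\rho_g^{\mathrm{pred}}(\chi))\big)\,\mathrm{Tr}\big(\bar\rho\,\mathbb D_\alpha(\rho_e^{\mathrm{pred}}(\chi))\big)$ if $\mathrm{Tr}(\bar\rho\,\rho^{\mathrm{pred}}(\chi))<\eta$ (any choice among the maximisers is allowed). The closed-loop chain $\chi_k=(\rho_k,\beta_{1,k},\dots,\beta_{d,k})$ is defined by $$\rho_{k+1}=\mathbb M_{s_k}\big(\mathbb D_{\beta_{d,k}}(\rho_k)\big),\qquad \beta_{1,k+1}=\alpha(\chi_k),\qquad \beta_{l,k+1}=\beta_{l-1,k}\quad(2\le l\le d),$$ where, conditionally on the past up to time $k$, the detection result $s_k\in\{g,e\}$ takes the value $s$ with probability $\mathrm{Tr}\big(M_s\mathbb D_{\beta_{d,k}}(\rho_k)M_s^\dagger\big)$. Theorem. There are $\epsilon_0>0$ and $\eta_0>0$ such that for all $0<\epsilon<\epsilon_0$ and $0<\eta<\eta_0$, for every such feedback law and every initial condition $\chi_0\in\mathcal X\times\mathbb C^d$, the state $\chi_k$ converges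 almost surely to $(\bar\rho,0,\dots,0)$ as $k\to\infty$. -/

import Mathlib

open MeasureTheory Filter Topology
open scoped Matrix ComplexOrder

noncomputable section

namespace PhotonBox

/-- Operators on the cavity space `ℂ^(N+1)` truncated to `N` photons, written as matrices in the
Fock basis `|0⟩, …, |N⟩`. -/
abbrev Op (N : ℕ) : Type := Matrix (Fin (N + 1)) (Fin (N + 1)) ℂ

/-- The truncated annihilation operator: `a |0⟩ = 0` and `a |n⟩ = √n |n-1⟩`. -/
def annihilation (N : ℕ) : Op N :=
  Matrix.of fun i j => if (i : ℕ) + 1 = (j : ℕ) then ((Real.sqrt (j : ℕ) : ℝ) : ℂ) else 0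

/-- The projector `|n⟩⟨n|` on the Fock state with `n` photons. -/
def fock {N : ℕ} (n : Fin (N + 1)) : Op N := Matrix.single n n 1

/-- The set of density matrices: positive semidefinite (in particular Hermitian), of trace one. -/
def densityMatrices (N : ℕ) : Set (Op N) := {ρ | ρ.PosSemidef ∧ ρ.trace = 1}

/-- The displacement operator `D_α = exp (α a† - α* a)`. -/
def displacement {N : ℕ} (α : ℂ) : Op N :=
  NormedSpace.exp (α • (annihilation N)ᴴ - (star α) • annihilation N)

/-- The map `ρ ↦ D_α ρ D_α†`. -/
def displace {N : ℕ} (α : ℂ) (ρ : Op N) : Op N := displacement α * ρ * (displacement α)ᴴ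

/-- The two possible detection results of an atom. -/
inductive Outcome : Type
  | g
  | e

/-- The measurement operators `M_g = cos (φ₀ + ϑ N)` and `M_e = sin (φ₀ + ϑ N)`, where `N` is the
photon-number operator; they are diagonal in the Fock basis. -/
def measOp {N : ℕ} (φ₀ ϑ : ℝ) : Outcome → Op N
  | Outcome.g => Matrix.diagonal fun n => ((Real.cos (φ₀ + ϑ * ((n : ℕ) : ℝ)) : ℝ) : ℂ)
  | Outcome.e => Matrix.diagonal fun n => ((Real.sin (φ₀ + ϑ * ((n : ℕ) : ℝ)) : ℝ) : ℂ)

/-- The spectrum of `A` is not degenerate: every root of the characteristic polynomial is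
simple. -/
def NondegenerateSpectrum {N : ℕ} (A : Op N) : Prop := A.charpoly.roots.Nodup

/-- The standing assumption on the parameters: `M_g`, `M_e` are invertible and the spectra of
`M_g† M_g` and `M_e† M_e` are not degenerate. -/
def Admissible (N : ℕ) (φ₀ ϑ : ℝ) : Prop :=
  ∀ o : Outcome, IsUnit (measOp (N := N) φ₀ ϑ o) ∧
    NondegenerateSpectrum ((measOp (N := N) φ₀ ϑ o)ᴴ * measOp φ₀ ϑ o)

/-- The unnormalised measurement map `ρ ↦ M_o ρ M_o†`. -/
def measureMap {N : ℕ} (φ₀ ϑ : ℝ) (o : Outcome) (ρ : Op N) : Op N :=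
  measOp φ₀ ϑ o * ρ * (measOp φ₀ ϑ o)ᴴ

/-- The jump map `𝕄_o (ρ) = M_o ρ M_o† / tr (M_o ρ M_o†)`. -/
def jump {N : ℕ} (φ₀ ϑ : ℝ) (o : Outcome) (ρ : Op N) : Op N :=
  (measureMap φ₀ ϑ o ρ).trace⁻¹ • measureMap φ₀ ϑ o ρ

/-- The Kraus map `𝕂_α (ρ) = M_g D_α ρ D_α† M_g† + M_e D_α ρ D_α† M_e†`. -/
def kraus {N : ℕ} (φ₀ ϑ : ℝ) (α : ℂ) (ρ : Op N) : Op N :=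
  measureMap φ₀ ϑ Outcome.g (displace α ρ) + measureMap φ₀ ϑ Outcome.e (displace α ρ)

/-- States `χ = (ρ, β_1, …, β_d)` of the chain with a delay of `d = m + 1` steps; `β_l` is the
coordinate of index `l - 1` of the second component. -/
abbrev State (N m : ℕ) : Type := Op N × (Fin (m + 1) → ℂ)

/-- `ρ^pred (χ) = 𝕂_{β_1} ∘ ⋯ ∘ 𝕂_{β_d} (ρ)`. -/
def pred {N m : ℕ} (φ₀ ϑ : ℝ) (χ : State N m) : Op N :=
  (List.ofFn χ.2).foldr (kraus φ₀ ϑ) χ.1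

/-- `ρ^pred_o (χ) = 𝕂_{β_1} ∘ ⋯ ∘ 𝕂_{β_{d-1}} (M_o D_{β_d} ρ D_{β_d}† M_o†)`. -/
def predOutcome {N m : ℕ} (φ₀ ϑ : ℝ) (o : Outcome) (χ : State N m) : Op N :=
  (List.ofFn (Fin.init χ.2)).foldr (kraus φ₀ ϑ)
    (measureMap φ₀ ϑ o (displace (χ.2 (Fin.last m)) χ.1))

/-- `tr (ρ̄ ρ)` for the target `ρ̄ = |n̄⟩⟨n̄|`; it is real when `ρ` is Hermitian. -/
def fidelity {N : ℕ} (nbar : Fin (N + 1)) (ρ : Op N) : ℝ := (fock nbar * ρ).trace.re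

/-- `α` is a value prescribed by the feedback law at the state `χ`: it equals
`ε tr (ρ̄ [ρ^pred, a])` if `tr (ρ̄ ρ^pred) ≥ η`, and it is one of the maximisers over the disc
`|α| ≤ ᾱ` of `tr (ρ̄ 𝔻_α (ρ^pred_g)) tr (ρ̄ 𝔻_α (ρ^pred_e))` if `tr (ρ̄ ρ^pred) < η`. -/
def IsFeedbackValue {N m : ℕ} (φ₀ ϑ : ℝ) (nbar : Fin (N + 1)) (αbar ε η : ℝ)
    (χ : State N m) (α : ℂ) : Prop :=
  (η ≤ fidelity nbar (pred φ₀ ϑ χ) →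
    α = (ε : ℂ) * (fock nbar *
      (pred φ₀ ϑ χ * annihilation N - annihilation N * pred φ₀ ϑ χ)).trace) ∧
  (fidelity nbar (pred φ₀ ϑ χ) < η →
    ‖α‖ ≤ αbar ∧ ∀ α' : ℂ, ‖α'‖ ≤ αbar →
      fidelity nbar (displace α' (predOutcome φ₀ ϑ Outcome.g χ)) *
          fidelity nbar (displace α' (predOutcome φ₀ ϑ Outcome.e χ)) ≤
        fidelity nbar (displace α (predOutcome φ₀ ϑ Outcome.g χ)) *
          fidelity nbar (displace α (predOutcome φ₀ ϑ Outcome.e χ)))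

/-- `u` is a static state feedback obeying the feedback law at every state `χ ∈ 𝒳 × ℂ^d`; where
the maximiser is not unique, `u` may choose any of them. -/
def IsFeedbackLaw {N m : ℕ} (φ₀ ϑ : ℝ) (nbar : Fin (N + 1)) (αbar ε η : ℝ)
    (u : State N m → ℂ) : Prop :=
  ∀ χ : State N m, χ.1 ∈ densityMatrices N → IsFeedbackValue φ₀ ϑ nbar αbar ε η χ (u χ)

/-- One step of the dynamics from `χ` under the control `α` and the detection result `o`:
`ρ⁺ = 𝕄_o (𝔻_{β_d} (ρ))`, `β_1⁺ = α` and `β_l⁺ = β_{l-1}` for `l = 2, …, d`. -/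
def step {N m : ℕ} (φ₀ ϑ : ℝ) (χ : State N m) (α : ℂ) (o : Outcome) : State N m :=
  (jump φ₀ ϑ o (displace (χ.2 (Fin.last m)) χ.1), Fin.cons α (Fin.init χ.2))

/-- The probability `tr (M_o D_{β_d} ρ D_{β_d}† M_o†)` of the detection result `o` at `χ`. -/
def outcomeProb {N m : ℕ} (φ₀ ϑ : ℝ) (o : Outcome) (χ : State N m) : ℝ :=
  (measureMap φ₀ ϑ o (displace (χ.2 (Fin.last m)) χ.1)).trace.re

/-- `χ_k` is a realisation of the closed-loop Markov chain with feedback `u` started at `χ₀`, with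
detection results `s_k`, on a probability space with filtration `ℱ`: `χ_k` is known at time `k`,
`s_k` is known at time `k + 1`, the law of `s_k` conditionally on `ℱ k` is given by
`outcomeProb · χ_k`, and `χ_{k+1}` is obtained from `χ_k`, the control `u χ_k` and `s_k`. -/
structure IsClosedLoopChain {N m : ℕ} (φ₀ ϑ : ℝ) (u : State N m → ℂ) (χ₀ : State N m)
    {Ω : Type*} {mΩ : MeasurableSpace Ω} (μ : Measure Ω) (ℱ : Filtration ℕ mΩ)
    (χ : ℕ → Ω → State N m) (s : ℕ → Ω → Outcome) : Prop where
  init : ∀ ω, χ 0 ω = χ₀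
  step_eq : ∀ k ω, χ (k + 1) ω = step φ₀ ϑ (χ k ω) (u (χ k ω)) (s k ω)
  state_measurable : ∀ k, StronglyMeasurable[ℱ k] (χ k)
  outcome_measurable : ∀ k o, MeasurableSet[ℱ (k + 1)] {ω | s k ω = o}
  outcome_law : ∀ k o,
    μ[Set.indicator {ω | s k ω = o} (fun _ => (1 : ℝ)) | ℱ k] =ᵐ[μ]
      fun ω => outcomeProb φ₀ ϑ o (χ k ω)

end PhotonBox

end

open PhotonBox

/-!
Let `V = ⟨n̄| ρ^pred |n̄⟩` be the fidelity of the predicted state. Conditionally on the detection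
result `o`, the next predicted fidelity is `q_o / p_o`, where `p_o` is the probability of `o` and
`q_o = ⟨n̄| 𝔻_α (ρ^pred_o) |n̄⟩` (`fidelity_pred_step`); since the measurement leaves the
populations of the Fock states unchanged on average, `q_g + q_e = ⟨n̄| 𝔻_α (ρ^pred) |n̄⟩`.

With one Lyapunov function for both regimes of the feedback, `W = V + V ^ 2` (`lyapunov`), the mean
of `W` never decreases.

* If `V ≥ η`, the control is `α = ε g` with `g = tr (ρ̄ [ρ^pred, a])`. To first order `α` raises
  the fidelity by `2 Re (α* g)`, with an error `O(|α| ^ 2)` uniform in the state, so for small `ε`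
  the mean of `V` grows by at least `ε |g| ^ 2` (`exists_fidelity_displace_gradient_ge`). The mean
  of `V ^ 2` grows at least by the square of the spread `q_g p_e - q_e p_g` of the two outcomes.
* If `V < η`, the maximising control makes both `q_g` and `q_e` at least some `δ > 0` independent of
  the state, so `V ≥ δ ≥ 2 η` after the step and the gain is at least `η`
  (`exists_le_fidelity_displace_of_max`). The existence of `δ` follows by compactness from the fact
  that a displacement of small amplitude `r` and generic phase makes two given density matrices
  overlap with `|n̄⟩`: the matrix element of `D_r` between `n̄` and `m` is of exact order
  `r ^ |n̄ - m|`, hence nonzero, and as a function of the phase the amplitudes are nonzero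
  polynomials.

As `W` is bounded, the gains have a finite sum in mean and tend to `0` almost surely
(`IsClosedLoopChain.ae_tendsto_drift`). Hence almost surely `V ≥ η` from some time on, and `g` and
the spread tend to `0`. In particular the controls, and with them the delayed controls in the state,
tend to `0`. A limit point `A` of `ρ_k`, as well as its successor after a detection, then has spread
zero, which says that the probability of the outcome `g` is `cos² (φ₀ + ϑ n̄)`. These two equations
make the variance of `cos² (φ₀ + ϑ N)` in the state `A` vanish, and nondegeneracy gives
`A = |n̄⟩⟨n̄|` (`eq_fock_of_probG_eq`, `tendsto_fock`).
-/

noncomputable section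

namespace PhotonBox

/-! ### Density matrices -/

theorem trace_fock_mul {N : ℕ} (n : Fin (N + 1)) (A : Op N) : (fock n * A).trace = A n n := by
  simp [fock, Matrix.trace_mul_comm _ A, Matrix.trace_mul_single]

theorem fidelity_eq {N : ℕ} (n : Fin (N + 1)) (A : Op N) : fidelity n A = (A n n).re := by
  rw [fidelity, trace_fock_mul]

theorem re_diag_nonneg {N : ℕ} {A : Op N} (hA : A.PosSemidef) (n : Fin (N + 1)) :
    0 ≤ (A n n).re :=
  (Complex.nonneg_iff.1 hA.diag_nonneg).1

theorem fidelity_nonneg {N : ℕ} {A : Op N} (hA : A.PosSemidef) (n : Fin (N + 1)) :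
    0 ≤ fidelity n A := by
  rw [fidelity_eq]; exact re_diag_nonneg hA n

theorem fidelity_le_trace {N : ℕ} {A : Op N} (hA : A.PosSemidef) (n : Fin (N + 1)) :
    fidelity n A ≤ A.trace.re := by
  rw [fidelity_eq, Matrix.trace, Complex.re_sum]
  exact Finset.single_le_sum (f := fun i => (A i i).re) (fun i _ => re_diag_nonneg hA i)
    (Finset.mem_univ n)

theorem ofReal_re_trace {N : ℕ} {A : Op N} (hA : A.PosSemidef) :
    ((A.trace.re : ℝ) : ℂ) = A.trace :=
  Complex.ext rfl (by simpa using (Complex.nonneg_iff.1 hA.trace_nonneg).2)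

theorem diag_mul_mul_conjTranspose {N : ℕ} (B A : Op N) (n : Fin (N + 1)) :
    (B * A * Bᴴ) n n = star (star (B n)) ⬝ᵥ A *ᵥ star (B n) := by
  simp only [Matrix.mul_apply, dotProduct, Matrix.mulVec, Matrix.conjTranspose_apply, star_star,
    Pi.star_apply, Finset.sum_mul, Finset.mul_sum]
  rw [Finset.sum_comm]
  simp only [mul_assoc]

/-- A positive semidefinite matrix annihilates every basis vector on which its quadratic form
vanishes. -/
theorem apply_eq_zero_of_diag_eq_zero {N : ℕ} {A : Op N} (hA : A.PosSemidef) {j : Fin (N + 1)}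
    (h : A j j = 0) (i : Fin (N + 1)) : A i j = 0 := by
  have := (hA.dotProduct_mulVec_zero_iff (Pi.single j 1)).1 (by simp [h])
  simpa using congrFun this i

/-- Off-diagonal entries are controlled by the diagonal: the quadratic form at `t e_i - e_j`, with
a suitable phase `t`, gives `2 |A i j| ≤ A i i + A j j`. -/
theorem norm_apply_le_one {N : ℕ} {A : Op N} (hA : A ∈ densityMatrices N) (i j : Fin (N + 1)) :
    ‖A i j‖ ≤ 1 := by
  obtain ⟨hA, htr⟩ := hA
  have hle : ∀ k, (A k k).re ≤ 1 := fun k => by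
    have := fidelity_le_trace hA k
    rwa [fidelity_eq, htr, Complex.one_re] at this
  by_cases h0 : A i j = 0
  · simp [h0]
  set t : ℂ := A i j / ‖A i j‖ with ht
  have hn : (‖A i j‖ : ℂ) ≠ 0 := by simpa using h0
  have hq := hA.dotProduct_mulVec_nonneg (Pi.single i t - Pi.single j 1)
  have hji : A j i = star (A i j) := (hA.isHermitian.apply j i).symm
  have h1 : star t * t = 1 := by
    rw [ht, Complex.star_def, map_div₀, Complex.conj_ofReal, div_mul_div_comm, mul_comm,
      Complex.mul_conj, Complex.normSq_eq_norm_sq]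
    push_cast
    field_simp
  have h2 : star t * A i j = ‖A i j‖ := by
    rw [ht, Complex.star_def, map_div₀, Complex.conj_ofReal, div_mul_eq_mul_div, mul_comm,
      Complex.mul_conj, Complex.normSq_eq_norm_sq]
    push_cast
    field_simp
  have h3 : star (A i j) * t = ‖A i j‖ := by
    have := congrArg star h2
    simpa [mul_comm] using this
  have : star (Pi.single i t - Pi.single j 1 : Fin (N + 1) → ℂ) ⬝ᵥ
      A *ᵥ (Pi.single i t - Pi.single j 1) = A i i + A j j - 2 * ‖A i j‖ := by
    simp only [star_sub, Matrix.mulVec_sub, dotProduct_sub, sub_dotProduct, ← Pi.single_star,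
      single_dotProduct, Matrix.mulVec_single, Pi.smul_apply, Matrix.col_apply, star_one,
      MulOpposite.smul_eq_mul_unop, MulOpposite.unop_op, hji]
    linear_combination A i i * h1 - h2 - h3
  rw [this] at hq
  have := (Complex.nonneg_iff.1 hq).1
  simp at this
  linarith [hle i, hle j]

theorem isCompact_densityMatrices (N : ℕ) : IsCompact (densityMatrices N) := by
  have hK : IsCompact (Set.pi Set.univ fun _ : Fin (N + 1) =>
      Set.pi Set.univ fun _ : Fin (N + 1) => Metric.closedBall (0 : ℂ) 1) :=
    isCompact_univ_pi fun _ => isCompact_univ_pi fun _ => isCompact_closedBall 0 1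
  refine IsCompact.of_isClosed_subset (X := Fin (N + 1) → Fin (N + 1) → ℂ) hK ?_ ?_
  · have : densityMatrices N = {A : Op N | Aᴴ = A} ∩
        (⋂ x : Fin (N + 1) → ℂ, {A : Op N | 0 ≤ star x ⬝ᵥ A *ᵥ x}) ∩ {A | A.trace = 1} := by
      ext A
      simp [densityMatrices, Matrix.posSemidef_iff_dotProduct_mulVec, Matrix.IsHermitian]
    rw [this]
    refine IsClosed.inter (IsClosed.inter ?_ (isClosed_iInter fun x => ?_)) ?_
    · exact isClosed_eq continuous_id.matrix_conjTranspose continuous_id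
    · exact isClosed_le continuous_const
        (Continuous.dotProduct continuous_const (continuous_id.matrix_mulVec continuous_const))
    · exact isClosed_eq continuous_id.matrix_trace continuous_const
  · intro A hA i _ j _
    simpa using norm_apply_le_one hA i j

theorem inv_smul_mem_densityMatrices {N : ℕ} {A : Op N} (hA : A.PosSemidef)
    (h : 0 < A.trace.re) : A.trace⁻¹ • A ∈ densityMatrices N := by
  have h0 : A.trace ≠ 0 := fun h0 => by simp [h0] at h
  refine ⟨hA.smul ?_, ?_⟩
  · exact inv_nonneg.2 hA.trace_nonneg
  · rw [Matrix.trace_smul, smul_eq_mul, inv_mul_cancel₀ h0]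

/-! ### The displacement operators -/

/-- The skew-Hermitian generator `α a† - α* a` of the displacement `D_α`. -/
def generator {N : ℕ} (α : ℂ) : Op N := α • (annihilation N)ᴴ - (star α) • annihilation N

theorem generator_conjTranspose {N : ℕ} (α : ℂ) : (generator (N := N) α)ᴴ = -generator α := by
  simp [generator]

theorem displacement_unitary {N : ℕ} (α : ℂ) :
    (displacement (N := N) α)ᴴ * displacement α = 1 := by
  change (NormedSpace.exp (generator α))ᴴ * NormedSpace.exp (generator α) = 1
  rw [← Matrix.exp_conjTranspose, generator_conjTranspose, Matrix.exp_neg]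
  exact Matrix.nonsing_inv_mul _ ((Matrix.isUnit_iff_isUnit_det _).1 (Matrix.isUnit_exp _))

theorem trace_displace {N : ℕ} (α : ℂ) (A : Op N) : (displace α A).trace = A.trace := by
  rw [displace, Matrix.trace_mul_comm, ← mul_assoc, displacement_unitary, one_mul]

theorem displace_posSemidef {N : ℕ} (α : ℂ) {A : Op N} (hA : A.PosSemidef) :
    (displace α A).PosSemidef :=
  hA.mul_mul_conjTranspose_same _

theorem displace_zero {N : ℕ} (A : Op N) : displace 0 A = A := by
  simp [displace, displacement]

theorem displace_add {N : ℕ} (α : ℂ) (A B : Op N) :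
    displace α (A + B) = displace α A + displace α B := by
  simp [displace, mul_add, add_mul]

theorem displace_smul {N : ℕ} (α c : ℂ) (A : Op N) : displace α (c • A) = c • displace α A := by
  simp [displace]

theorem continuous_generator {N : ℕ} : Continuous (generator (N := N)) := by
  unfold generator; fun_prop

theorem continuous_displacement {N : ℕ} : Continuous (displacement (N := N)) := by
  have h : Continuous (NormedSpace.exp : Op N → Op N) := by
    open scoped Matrix.Norms.Operator in exact NormedSpace.exp_continuous
  exact h.comp continuous_generator

theorem continuous_displace {N : ℕ} {X : Type*} [TopologicalSpace X] {f : X → ℂ} {g : X → Op N}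
    (hf : Continuous f) (hg : Continuous g) : Continuous fun x => displace (f x) (g x) := by
  have h : Continuous fun x => (displacement (f x) : Op N) := continuous_displacement.comp hf
  exact (h.matrix_mul hg).matrix_mul h.matrix_conjTranspose

theorem exp_sub_sum_isBigO {𝔸 X : Type*} [NormedRing 𝔸] [NormedAlgebra ℂ 𝔸] [CompleteSpace 𝔸]
    {l : Filter X} {f : X → 𝔸} (hf : Tendsto f l (𝓝 0)) (n : ℕ) :
    (fun x => NormedSpace.exp (f x) - ∑ k ∈ Finset.range n, ((k.factorial : ℂ)⁻¹) • f x ^ k)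
      =O[l] fun x => ‖f x‖ ^ n := by
  have h := (NormedSpace.exp_hasFPowerSeriesAt_zero (𝕂 := ℂ) (𝔸 := 𝔸)).isBigO_sub_partialSum_pow n
  have h2 := h.comp_tendsto hf
  simpa [FormalMultilinearSeries.partialSum, NormedSpace.expSeries_apply_eq, Function.comp_def]
    using h2

/-- Taylor expansion of the matrix elements of `D_α` at `α = 0`. -/
theorem displacement_sub_sum_isBigO {N : ℕ} (n : ℕ) (i j : Fin (N + 1)) :
    (fun α : ℂ => (displacement α -
      ∑ k ∈ Finset.range n, ((k.factorial : ℂ)⁻¹) • generator α ^ k : Op N) i j)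
      =O[𝓝 0] fun α => ‖α‖ ^ n := by
  open scoped Matrix.Norms.Operator in
  have hg : Tendsto (generator (N := N)) (𝓝 0) (𝓝 0) := by
    have := (continuous_generator (N := N)).tendsto 0
    simpa [generator] using this
  have h := exp_sub_sum_isBigO (𝔸 := Op N) hg n
  have hgO : (fun α => ‖generator (N := N) α‖ ^ n) =O[𝓝 0] fun α : ℂ => ‖α‖ ^ n := by
    refine Asymptotics.IsBigO.pow (Asymptotics.IsBigO.norm_norm ?_) n
    refine Asymptotics.IsBigO.of_bound (‖(annihilation N)ᴴ‖ + ‖annihilation N‖)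
      (Eventually.of_forall fun α => ?_)
    refine (norm_sub_le _ _).trans ?_
    rw [norm_smul, norm_smul, norm_star]
    linarith
  refine Asymptotics.IsBigO.trans ?_ (h.trans hgO)
  refine Asymptotics.IsBigO.of_bound 1 (Eventually.of_forall fun α => ?_)
  rw [one_mul]
  set A : Op N := displacement α -
      ∑ k ∈ Finset.range n, ((k.factorial : ℂ)⁻¹) • generator α ^ k
  have : ‖A i j‖₊ ≤ ‖A‖₊ := by
    rw [Matrix.linfty_opNNNorm_def]
    exact (Finset.single_le_sum (f := fun j => ‖A i j‖₊) (fun _ _ => zero_le)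
      (Finset.mem_univ j)).trans
      (Finset.le_sup (f := fun i => ∑ j, ‖A i j‖₊) (Finset.mem_univ i))
  exact this

/-! ### Second-order effect of a small displacement on the fidelity -/

/-- The complex number `tr (|n⟩⟨n| [A, a])`, the gradient at `α = 0` of the fidelity of `𝔻_α (A)`
up to a factor. -/
def fidelityGradient {N : ℕ} (n : Fin (N + 1)) (A : Op N) : ℂ :=
  (fock n * (A * annihilation N - annihilation N * A)).trace

theorem continuous_gradient {N : ℕ} (n : Fin (N + 1)) :
    Continuous (fidelityGradient (N := N) n) := by
  unfold fidelityGradient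
  exact Continuous.matrix_trace (by fun_prop)

theorem continuous_fidelity {N : ℕ} (n : Fin (N + 1)) : Continuous (fidelity (N := N) n) := by
  unfold fidelity
  exact Complex.continuous_re.comp (Continuous.matrix_trace (by fun_prop))

theorem re_generator_mul_apply {N : ℕ} (n : Fin (N + 1)) {A : Op N} (hA : A.IsHermitian) (α : ℂ) :
    ((generator α * A : Op N) n n).re = (star α * fidelityGradient n A).re := by
  have h : ((annihilation N)ᴴ * A) n n = star ((A * annihilation N) n n) := by
    rw [← Matrix.conjTranspose_apply, Matrix.conjTranspose_mul, hA.eq]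
  have h2 : (generator α * A : Op N) n n =
      α * star ((A * annihilation N) n n) - star α * (annihilation N * A) n n := by
    simp [generator, sub_mul, h]
  rw [h2, fidelityGradient, trace_fock_mul, Matrix.sub_apply, mul_sub, Complex.sub_re,
    Complex.sub_re]
  simp [Complex.mul_re]

/-- A displacement changes the fidelity by its first-order term, up to an error `O(|α|²)` that is
uniform over all density matrices. -/
theorem exists_fidelity_displace_ge {N : ℕ} (n : Fin (N + 1)) :
    ∃ C > (0 : ℝ), ∃ r > (0 : ℝ), ∀ α : ℂ, ‖α‖ < r → ∀ A ∈ densityMatrices N,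
      fidelity n A + 2 * (star α * fidelityGradient n A).re - C * ‖α‖ ^ 2 ≤
        fidelity n (displace α A) := by
  let T : ℂ → Op N := fun α => 1 + generator α
  have hD : ∀ i, (fun α : ℂ => displacement α n i - T α n i) =O[𝓝 0] fun α => ‖α‖ ^ 2 := by
    intro i
    simpa [T, Finset.sum_range_succ, Nat.factorial] using
      displacement_sub_sum_isBigO (N := N) 2 n i
  have hD1 : ∀ i, (fun α : ℂ => displacement α n i) =O[𝓝 0] fun _ => (1 : ℝ) := fun i =>
    ((continuous_displacement.matrix_elem n i).tendsto 0).isBigO_one ℝ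
  have hT1 : ∀ i, (fun α : ℂ => T α n i) =O[𝓝 0] fun _ => (1 : ℝ) := fun i =>
    (((continuous_const.add continuous_generator).matrix_elem n i).tendsto 0).isBigO_one ℝ
  have hstar : ∀ {f : ℂ → ℂ} {g : ℂ → ℝ}, f =O[𝓝 0] g → (fun α => star (f α)) =O[𝓝 0] g :=
    fun h => (Asymptotics.isBigO_of_le _ fun x => by simp).trans h
  -- the error in the coefficient of `A i j` in the fidelity
  let E : Fin (N + 1) → Fin (N + 1) → ℂ → ℂ := fun i j α =>
    displacement α n i * star (displacement α n j) - T α n i * star (T α n j)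
  have hE : ∀ i j, (E i j) =O[𝓝 0] fun α : ℂ => ‖α‖ ^ 2 := by
    intro i j
    have h1 := (hD i).mul (hstar (hD1 j))
    have h2 := (hT1 i).mul (hstar (hD j))
    simp only [mul_one, one_mul] at h1 h2
    refine (h1.add h2).congr_left fun α => ?_
    simp only [E, star_sub]
    ring
  have hS : (fun α => ∑ i, ∑ j, ‖E i j α‖) =O[𝓝 0] fun α : ℂ => ‖α‖ ^ 2 :=
    Asymptotics.IsBigO.fun_sum fun i _ => Asymptotics.IsBigO.fun_sum fun j _ => (hE i j).norm_left
  obtain ⟨C, hC, hb⟩ := hS.exists_pos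
  obtain ⟨r, hr, hb⟩ := Metric.eventually_nhds_iff.1 hb.bound
  refine ⟨C, hC, r, hr, fun α hα A hA => ?_⟩
  have hb := hb (y := α) (by simpa using hα)
  rw [Real.norm_of_nonneg (by positivity), Real.norm_of_nonneg (by positivity)] at hb
  have hexp : ∀ B : Op N, (B * A * Bᴴ) n n = ∑ i, ∑ j, B n i * star (B n j) * A i j := by
    intro B
    simp only [Matrix.mul_apply, Matrix.conjTranspose_apply, Finset.sum_mul]
    rw [Finset.sum_comm]
    exact Finset.sum_congr rfl fun i _ => Finset.sum_congr rfl fun j _ => by ring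
  have herr : ‖(displace α A) n n - (T α * A * (T α)ᴴ) n n‖ ≤ C * ‖α‖ ^ 2 := by
    refine le_trans ?_ hb
    rw [displace, hexp, hexp, ← Finset.sum_sub_distrib]
    refine (norm_sum_le _ _).trans (Finset.sum_le_sum fun i _ => ?_)
    rw [← Finset.sum_sub_distrib]
    refine (norm_sum_le _ _).trans (Finset.sum_le_sum fun j _ => ?_)
    rw [← sub_mul, norm_mul]
    exact mul_le_of_le_one_right (norm_nonneg _) (norm_apply_le_one hA i j)
  have hre := (abs_le.1 ((Complex.abs_re_le_norm _).trans herr)).1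
  -- the quadratic term `K A K†` of the approximation is nonnegative and can be dropped
  have hmain : fidelity n A + 2 * (star α * fidelityGradient n A).re ≤
      ((T α * A * (T α)ᴴ) n n).re := by
    have hq := re_diag_nonneg (hA.1.mul_mul_conjTranspose_same (generator α)) n
    have h1 : T α * A * (T α)ᴴ = A + generator α * A + (generator α * A)ᴴ
        + generator α * A * (generator α)ᴴ := by
      simp only [T, Matrix.conjTranspose_add, Matrix.conjTranspose_one, Matrix.conjTranspose_mul,
        hA.1.isHermitian.eq]
      noncomm_ring
    have hc : (star ((generator α * A : Op N) n n)).re = ((generator α * A : Op N) n n).re :=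
      Complex.conj_re _
    rw [h1, Matrix.add_apply, Matrix.add_apply, Matrix.add_apply, Matrix.conjTranspose_apply,
      Complex.add_re, Complex.add_re, Complex.add_re, hc,
      re_generator_mul_apply n hA.1.isHermitian, fidelity_eq]
    linarith
  rw [Complex.sub_re] at hre
  rw [fidelity_eq n (displace α A)]
  linarith

theorem exists_norm_gradient_le {N : ℕ} (n : Fin (N + 1)) :
    ∃ G > (0 : ℝ), ∀ A ∈ densityMatrices N, ‖fidelityGradient n A‖ ≤ G := by
  obtain ⟨G, hG⟩ := (isCompact_densityMatrices N).exists_bound_of_continuousOn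
    (continuous_gradient n).continuousOn
  exact ⟨max G 1, by positivity, fun A hA => (hG A hA).trans (le_max_left _ _)⟩

/-- For a small gain `ε`, the displacement `α = ε tr (|n⟩⟨n| [A, a])` increases the fidelity. -/
theorem exists_fidelity_displace_gradient_ge {N : ℕ} (n : Fin (N + 1)) :
    ∃ ε₀ > (0 : ℝ), ∀ ε : ℝ, 0 < ε → ε < ε₀ → ∀ A ∈ densityMatrices N,
      fidelity n A + ε * ‖fidelityGradient n A‖ ^ 2 ≤
        fidelity n (displace ((ε : ℂ) * fidelityGradient n A) A) := by
  obtain ⟨C, hC, r, hr, h⟩ := exists_fidelity_displace_ge n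
  obtain ⟨G, hG, hGb⟩ := exists_norm_gradient_le n
  refine ⟨min (1 / C) (r / G), by positivity, fun ε hε hε' A hA => ?_⟩
  have h1 : ε * C < 1 := by
    rw [← lt_div_iff₀ hC]; exact hε'.trans_le (min_le_left _ _)
  have h2 : ε * G < r := by
    rw [← lt_div_iff₀ hG]; exact hε'.trans_le (min_le_right _ _)
  have hnorm : ‖(ε : ℂ) * fidelityGradient n A‖ = ε * ‖fidelityGradient n A‖ := by
    rw [norm_mul, Complex.norm_real, Real.norm_of_nonneg hε.le]
  have h3 := h ((ε : ℂ) * fidelityGradient n A) (by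
    rw [hnorm]
    exact (mul_le_mul_of_nonneg_left (hGb A hA) hε.le).trans_lt h2) A hA
  have h4 : (star ((ε : ℂ) * fidelityGradient n A) * fidelityGradient n A).re =
      ε * ‖fidelityGradient n A‖ ^ 2 := by
    rw [star_mul', Complex.star_def, Complex.conj_ofReal, mul_assoc,
      mul_comm (starRingEnd ℂ _), Complex.mul_conj, Complex.normSq_eq_norm_sq, ← Complex.ofReal_mul,
      Complex.ofReal_re]
  rw [h4, hnorm] at h3
  nlinarith [mul_nonneg hε.le (sq_nonneg ‖fidelityGradient n A‖)]

/-! ### Reaching the target level from an arbitrary pair of states -/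

/-- Powers of a Hessenberg matrix whose first superdiagonal does not vanish. -/
theorem hessenberg_pow_apply {R : Type*} [CommRing R] [NoZeroDivisors R] [Nontrivial R] {N : ℕ}
    {T : Matrix (Fin (N + 1)) (Fin (N + 1)) R}
    (h0 : ∀ i j : Fin (N + 1), (i : ℕ) + 1 < j → T i j = 0)
    (h1 : ∀ i j : Fin (N + 1), (i : ℕ) + 1 = j → T i j ≠ 0)
    (n : Fin (N + 1)) (k : ℕ) :
    (∀ m : Fin (N + 1), (n : ℕ) + k < m → (T ^ k) n m = 0) ∧
      ∀ m : Fin (N + 1), (n : ℕ) + k = m → (T ^ k) n m ≠ 0 := by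
  induction k with
  | zero =>
    refine ⟨fun m hm => ?_, fun m hm => ?_⟩
    · rw [pow_zero, Matrix.one_apply_ne]; rintro rfl; omega
    · obtain rfl : n = m := Fin.ext (by omega)
      simp
  | succ k ih =>
    refine ⟨fun m hm => ?_, fun m hm => ?_⟩
    · rw [pow_succ, Matrix.mul_apply]
      refine Finset.sum_eq_zero fun j _ => ?_
      rcases lt_or_ge ((n : ℕ) + k) j with hj | hj
      · rw [ih.1 j hj, zero_mul]
      · rw [h0 j m (by omega), mul_zero]
    · have hlt : (n : ℕ) + k < N + 1 := by omega
      rw [pow_succ, Matrix.mul_apply, Finset.sum_eq_single (⟨(n : ℕ) + k, hlt⟩ : Fin (N + 1))]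
      · exact mul_ne_zero (ih.2 _ rfl) (h1 _ _ (by simp only; omega))
      · intro j _ hj
        have hj' : (j : ℕ) ≠ n + k := fun h => hj (Fin.ext h)
        rcases lt_or_gt_of_ne hj' with hj | hj
        · rw [h0 j m (by omega), mul_zero]
        · rw [ih.1 j hj, zero_mul]
      · simp

theorem generator_one_apply {N : ℕ} (i j : Fin (N + 1)) :
    (generator 1 : Op N) i j = (if (j : ℕ) + 1 = i then ((Real.sqrt (i : ℕ) : ℝ) : ℂ) else 0) -
      if (i : ℕ) + 1 = j then ((Real.sqrt (j : ℕ) : ℝ) : ℂ) else 0 := by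
  simp only [generator, annihilation, one_smul, star_one, Matrix.sub_apply,
    Matrix.conjTranspose_apply, Matrix.of_apply]
  split_ifs <;> simp

/-- The matrix element of `(a† - a) ^ k` between two Fock states vanishes when their distance
exceeds `k`, and does not vanish when their distance is `k`. -/
theorem generator_one_pow_apply {N : ℕ} (n m : Fin (N + 1)) :
    (∀ k < Nat.dist n m, ((generator 1 : Op N) ^ k) n m = 0) ∧
      ((generator 1 : Op N) ^ Nat.dist n m) n m ≠ 0 := by
  have h0 : ∀ i j : Fin (N + 1), (i : ℕ) + 1 < j → (generator 1 : Op N) i j = 0 := by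
    intro i j hij
    rw [generator_one_apply, if_neg (by omega), if_neg (by omega), sub_zero]
  have h1 : ∀ i j : Fin (N + 1), (i : ℕ) + 1 = j → (generator 1 : Op N) i j ≠ 0 := by
    intro i j hij
    rw [generator_one_apply, if_neg (by omega), if_pos hij, zero_sub, neg_ne_zero,
      Complex.ofReal_ne_zero]
    exact (Real.sqrt_pos.2 (by rw [← hij]; positivity)).ne'
  have hsymm : ∀ k, ‖((generator 1 : Op N) ^ k) n m‖ = ‖((generator 1 : Op N) ^ k) m n‖ := by
    intro k
    rw [← norm_star, ← Matrix.conjTranspose_apply, Matrix.conjTranspose_pow,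
      generator_conjTranspose, neg_pow]
    rcases neg_one_pow_eq_or (Op N) k with h | h <;> simp [h]
  rcases le_total (n : ℕ) m with h | h
  · have hd : Nat.dist n m = m - n := Nat.dist_eq_sub_of_le h
    exact ⟨fun k hk => (hessenberg_pow_apply h0 h1 n k).1 m (by omega),
      (hessenberg_pow_apply h0 h1 n _).2 m (by omega)⟩
  · have hd : Nat.dist n m = n - m := Nat.dist_eq_sub_of_le_right h
    refine ⟨fun k hk => ?_, ?_⟩
    · rw [← norm_eq_zero, hsymm, norm_eq_zero]
      exact (hessenberg_pow_apply h0 h1 m k).1 n (by omega)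
    · rw [← norm_ne_zero_iff, hsymm, norm_ne_zero_iff]
      exact (hessenberg_pow_apply h0 h1 m _).2 n (by omega)

theorem generator_ofReal {N : ℕ} (r : ℝ) : (generator (r : ℂ) : Op N) = (r : ℂ) • generator 1 := by
  simp [generator, smul_sub]

/-- A small positive displacement has no vanishing matrix element: the element between `n` and
`m` has order exactly `r ^ |n - m|`. -/
theorem eventually_displacement_apply_ne_zero {N : ℕ} (n m : Fin (N + 1)) :
    ∀ᶠ r : ℝ in 𝓝[>] 0, (displacement (r : ℂ) : Op N) n m ≠ 0 := by
  set k := Nat.dist n m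
  set c : ℂ := ((k.factorial : ℂ)⁻¹) * ((generator 1 : Op N) ^ k) n m with hc
  have hc0 : 0 < ‖c‖ := norm_pos_iff.2
    (mul_ne_zero (by simpa using k.factorial_ne_zero) (generator_one_pow_apply n m).2)
  obtain ⟨C, hC, hb⟩ := (displacement_sub_sum_isBigO (N := N) (k + 1) n m).exists_pos
  have hof : Tendsto (fun r : ℝ => (r : ℂ)) (𝓝[>] 0) (𝓝 0) :=
    (Complex.continuous_ofReal.tendsto' 0 0 (by simp)).mono_left nhdsWithin_le_nhds
  have hsmall : ∀ᶠ r : ℝ in 𝓝[>] 0, r < ‖c‖ / C :=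
    nhdsWithin_le_nhds (eventually_lt_nhds (by positivity))
  filter_upwards [hof.eventually hb.bound, hsmall, self_mem_nhdsWithin] with r h1 h2 hr h3
  have hr : 0 < r := hr
  have hsum : (∑ j ∈ Finset.range (k + 1), ((j.factorial : ℂ)⁻¹) • generator (r : ℂ) ^ j : Op N) n m
      = (r : ℂ) ^ k * c := by
    rw [Finset.sum_range_succ, Matrix.add_apply, Matrix.sum_apply, Finset.sum_eq_zero, zero_add]
    · rw [generator_ofReal, smul_pow, Matrix.smul_apply, Matrix.smul_apply, smul_eq_mul,
        smul_eq_mul, hc]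
      ring
    · intro j hj
      rw [generator_ofReal, smul_pow, Matrix.smul_apply, Matrix.smul_apply,
        (generator_one_pow_apply n m).1 j (Finset.mem_range.1 hj), smul_zero, smul_zero]
  rw [Matrix.sub_apply, h3, hsum, zero_sub, norm_neg, norm_mul, norm_pow, Complex.norm_real,
    Real.norm_of_nonneg hr.le, Real.norm_of_nonneg (by positivity), pow_succ] at h1
  rw [lt_div_iff₀ hC] at h2
  have : r ^ k * ‖c‖ ≤ r ^ k * (C * r) := by linarith
  have := le_of_mul_le_mul_left this (by positivity)
  linarith

/-- Rotating the displacement in phase space: `D_{z r} = z^N D_r z^{-N}` for `|z| = 1`. -/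
theorem displacement_mul_apply {N : ℕ} {z : ℂ} (hz : z * star z = 1) (r : ℝ) (n m : Fin (N + 1)) :
    (displacement (z * r) : Op N) n m
      = z ^ (n : ℕ) * (displacement (r : ℂ) : Op N) n m * star z ^ (m : ℕ) := by
  set U : Op N := Matrix.diagonal fun i => z ^ (i : ℕ)
  set V : Op N := Matrix.diagonal fun i => star z ^ (i : ℕ)
  have hUV : U * V = 1 := by
    simp only [U, V, Matrix.diagonal_mul_diagonal, ← mul_pow, hz, one_pow, Matrix.diagonal_one]
  have hinv : U⁻¹ = V := Matrix.inv_eq_right_inv hUV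
  have hU : IsUnit U := IsUnit.of_mul_eq_one _ hUV
  have hgen : (generator (z * r) : Op N) = U * generator (r : ℂ) * U⁻¹ := by
    rw [hinv]
    ext i j
    have hr : star (r : ℂ) = r := by simp
    simp only [generator, U, V, Matrix.mul_diagonal, Matrix.diagonal_mul, Matrix.sub_apply,
      Matrix.smul_apply, smul_eq_mul, Matrix.conjTranspose_apply, annihilation, Matrix.of_apply,
      star_mul', hr]
    have hpow : ∀ k : ℕ, z ^ k * star z ^ k = 1 := fun k => by rw [← mul_pow, hz, one_pow]
    by_cases h1 : (j : ℕ) + 1 = i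
    · have h2 : ¬ (i : ℕ) + 1 = j := by omega
      rw [if_pos h1, if_neg h2, ← h1, pow_succ]
      linear_combination (-(z * r * star (((√((j : ℕ) + 1 : ℕ) : ℝ)) : ℂ))) * hpow j
    · by_cases h2 : (i : ℕ) + 1 = j
      · rw [if_neg h1, if_pos h2, ← h2, pow_succ, star_zero]
        linear_combination (star z * r * (((√((i : ℕ) + 1 : ℕ) : ℝ)) : ℂ)) * hpow i
      · rw [if_neg h1, if_neg h2]
        simp
  have h : (displacement (z * r) : Op N) = U * displacement (r : ℂ) * U⁻¹ := by
    change NormedSpace.exp (generator (z * r)) = U * NormedSpace.exp (generator (r : ℂ)) * U⁻¹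
    rw [hgen, Matrix.exp_conj U _ hU]
  rw [h, hinv]
  simp [U, V, Matrix.mul_diagonal, Matrix.diagonal_mul]

/-- A nonzero state is seen by the target after all but finitely many displacements of a fixed
small amplitude `r`: the relevant amplitudes are the values at the phase `z` of a nonzero
polynomial. -/
theorem exists_polynomial_fidelity_pos {N : ℕ} (n : Fin (N + 1)) {r : ℝ}
    (hr : ∀ m, (displacement (r : ℂ) : Op N) n m ≠ 0) {A : Op N} (hA : A.PosSemidef)
    (h0 : A ≠ 0) :
    ∃ P : Polynomial ℂ, P ≠ 0 ∧ ∀ z : ℂ, z * star z = 1 → P.eval z ≠ 0 →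
      0 < fidelity n (displace (z * r) A) := by
  obtain ⟨i, m, him⟩ : ∃ i m, A i m ≠ 0 := by
    by_contra! h
    exact h0 (Matrix.ext h)
  let E : Op N := displacement (r : ℂ)
  let P : Polynomial ℂ := ∑ j : Fin (N + 1), Polynomial.monomial (j : ℕ) (A i j * star (E n j))
  refine ⟨P, fun hP => ?_, fun z hz hPz => ?_⟩
  · have hcoeff : P.coeff m = A i m * star (E n m) := by
      simp only [P, Polynomial.finsetSum_coeff, Polynomial.coeff_monomial, ← Fin.ext_iff]
      simp
    rw [hP, Polynomial.coeff_zero] at hcoeff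
    exact mul_ne_zero him (star_ne_zero.2 (hr m)) hcoeff.symm
  · rw [fidelity_eq, displace, diag_mul_mul_conjTranspose]
    set v : Fin (N + 1) → ℂ := star ((displacement (z * r) : Op N) n) with hv
    have hAv : A *ᵥ v ≠ 0 := by
      intro h
      have hi := congrFun h i
      apply hPz
      have : z ^ (n : ℕ) * (A *ᵥ v) i = P.eval z := by
        simp only [P, Matrix.mulVec, dotProduct, Polynomial.eval_finsetSum, Finset.mul_sum,
          Polynomial.eval_monomial, hv, Pi.star_apply, displacement_mul_apply hz, star_mul',
          star_pow, star_star]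
        refine Finset.sum_congr rfl fun j _ => ?_
        have hpow : z ^ (n : ℕ) * star z ^ (n : ℕ) = 1 := by rw [← mul_pow, hz, one_pow]
        linear_combination (A i j * star (E n j) * z ^ (j : ℕ)) * hpow
      rw [← this, hi, Pi.zero_apply, mul_zero]
    have hnn := Complex.nonneg_iff.1 (hA.dotProduct_mulVec_nonneg v)
    refine lt_of_le_of_ne hnn.1 fun h => hAv ?_
    exact (hA.dotProduct_mulVec_zero_iff v).1 (Complex.ext h.symm hnn.2.symm)

theorem infinite_unit_circle : {z : ℂ | z * star z = 1}.Infinite := by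
  have h : (Metric.sphere (0 : ℂ) 1).Infinite := by
    refine (isPreconnected_sphere (by simp) 0 1).infinite_of_nontrivial
      ⟨1, by simp, -1, by simp, by norm_num⟩
  refine h.mono fun z hz => ?_
  rw [mem_sphere_zero_iff_norm] at hz
  rw [Set.mem_ofPred_eq, Complex.star_def, Complex.mul_conj, Complex.normSq_eq_norm_sq, hz]
  simp

/-- Some admissible displacement makes both of two density matrices overlap with the target. -/
theorem exists_displace_fidelity_pos {N : ℕ} (n : Fin (N + 1)) {αbar : ℝ} (hα : 0 < αbar)
    {A B : Op N} (hA : A ∈ densityMatrices N) (hB : B ∈ densityMatrices N) :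
    ∃ α : ℂ, ‖α‖ ≤ αbar ∧ 0 < fidelity n (displace α A) * fidelity n (displace α B) := by
  have hne : ∀ {A : Op N}, A ∈ densityMatrices N → A ≠ 0 := by
    rintro A hA rfl
    simpa using hA.2
  have hsmall : ∀ᶠ r : ℝ in 𝓝[>] 0, r < αbar := nhdsWithin_le_nhds (eventually_lt_nhds hα)
  obtain ⟨r, ⟨hr, hrα⟩, hr0⟩ := (((eventually_all.2 fun m =>
    eventually_displacement_apply_ne_zero n m).and hsmall).and self_mem_nhdsWithin).exists
  obtain ⟨P, hP, hPA⟩ := exists_polynomial_fidelity_pos n hr hA.1 (hne hA)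
  obtain ⟨Q, hQ, hQB⟩ := exists_polynomial_fidelity_pos n hr hB.1 (hne hB)
  obtain ⟨z, hz, hzPQ⟩ : ∃ z : ℂ, z * star z = 1 ∧ (P * Q).eval z ≠ 0 := by
    by_contra! h
    exact mul_ne_zero hP hQ (Polynomial.eq_zero_of_infinite_isRoot _
      (infinite_unit_circle.mono fun z hz => h z hz))
  rw [Polynomial.eval_mul] at hzPQ
  refine ⟨z * r, ?_, mul_pos (hPA z hz (left_ne_zero_of_mul hzPQ))
    (hQB z hz (right_ne_zero_of_mul hzPQ))⟩
  have hz1 : ‖z‖ = 1 := by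
    have h := congrArg norm hz
    rw [norm_mul, norm_star, norm_one] at h
    nlinarith [norm_nonneg z]
  rw [norm_mul, hz1, one_mul, Complex.norm_real, Real.norm_of_nonneg (le_of_lt hr0)]
  exact hrα.le

/-- The overlap in `exists_displace_fidelity_pos` can be bounded below uniformly, by compactness of
the set of density matrices. -/
theorem exists_uniform_displace_fidelity {N : ℕ} (n : Fin (N + 1)) {αbar : ℝ} (hα : 0 < αbar) :
    ∃ δ > (0 : ℝ), ∀ A ∈ densityMatrices N, ∀ B ∈ densityMatrices N,
      ∃ α : ℂ, ‖α‖ ≤ αbar ∧ δ ≤ fidelity n (displace α A) * fidelity n (displace α B) := by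
  let F : ℂ → Op N × Op N → ℝ := fun α p =>
    fidelity n (displace α p.1) * fidelity n (displace α p.2)
  have hD : ∀ α, Continuous (fun A : Op N => fidelity n (displace α A)) := fun α =>
    (continuous_fidelity n).comp (continuous_displace continuous_const continuous_id)
  have hF : ∀ α, Continuous (F α) := fun α =>
    ((hD α).comp continuous_fst).mul ((hD α).comp continuous_snd)
  have hK := (isCompact_densityMatrices N).prod (isCompact_densityMatrices N)
  let U : ℕ → Set (Op N × Op N) := fun k =>
    ⋃ α ∈ Metric.closedBall (0 : ℂ) αbar, {p | 1 / ((k : ℝ) + 1) < F α p}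
  have hU : ∀ k p, p ∈ U k ↔ ∃ α : ℂ, ‖α‖ ≤ αbar ∧ 1 / ((k : ℝ) + 1) < F α p := by
    intro k p
    simp [U]
  have hmono : Monotone U := by
    intro k l hkl p hp
    obtain ⟨α, hα, h⟩ := (hU k p).1 hp
    exact (hU l p).2 ⟨α, hα, (one_div_le_one_div_of_le (by positivity) (by gcongr)).trans_lt h⟩
  have hopen : ∀ k, IsOpen (U k) := fun k =>
    isOpen_biUnion fun α _ => isOpen_lt continuous_const (hF α)
  have hcover : densityMatrices N ×ˢ densityMatrices N ⊆ ⋃ k, U k := by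
    intro p hp
    obtain ⟨α, h1, h2⟩ := exists_displace_fidelity_pos n hα hp.1 hp.2
    obtain ⟨k, hk⟩ := exists_nat_one_div_lt h2
    exact Set.mem_iUnion.2 ⟨k, (hU k p).2 ⟨α, h1, hk⟩⟩
  obtain ⟨k, hk⟩ := hK.elim_directed_cover U hopen hcover hmono.directed_le
  refine ⟨1 / ((k : ℝ) + 1), by positivity, fun A hA B hB => ?_⟩
  obtain ⟨α, h1, h2⟩ := (hU k (A, B)).1 (hk (Set.mk_mem_prod hA hB))
  exact ⟨α, h1, h2.le⟩

/-! ### Measurement and prediction -/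

/-- The diagonal entries `cos (φ₀ + ϑ n)`, `sin (φ₀ + ϑ n)` of the measurement operators. -/
def amp (φ₀ ϑ : ℝ) : Outcome → ℕ → ℝ
  | Outcome.g, n => Real.cos (φ₀ + ϑ * n)
  | Outcome.e, n => Real.sin (φ₀ + ϑ * n)

/-- A lower bound for `∑ q_o ^ 2 / p_o` over the two outcomes: the square of the mean plus the
spread of `q_o / p_o`. -/
theorem sq_add_sq_le_sq_div_add_sq_div {p p' q q' : ℝ} (hp : 0 < p) (hp' : 0 < p')
    (h : p + p' = 1) :
    (q + q') ^ 2 + (q * p' - q' * p) ^ 2 ≤ q ^ 2 / p + q' ^ 2 / p' := by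
  have h1 : q ^ 2 / p + q' ^ 2 / p' = (q + q') ^ 2 + (q * p' - q' * p) ^ 2 / (p * p') := by
    field_simp
    obtain rfl : p' = 1 - p := by linarith
    ring
  rw [h1]
  have h2 : p * p' ≤ 1 := by nlinarith
  have := le_div_self (sq_nonneg (q * p' - q' * p)) (mul_pos hp hp') h2
  linarith

section

variable {N m : ℕ} (φ₀ ϑ : ℝ)

theorem amp_g_sq_add_amp_e_sq (n : ℕ) :
    amp φ₀ ϑ Outcome.g n ^ 2 + amp φ₀ ϑ Outcome.e n ^ 2 = 1 :=
  Real.cos_sq_add_sin_sq _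

theorem measOp_eq (o : Outcome) :
    (measOp φ₀ ϑ o : Op N) = Matrix.diagonal fun n : Fin (N + 1) => ((amp φ₀ ϑ o n : ℝ) : ℂ) := by
  cases o <;> rfl

theorem measureMap_apply (o : Outcome) (A : Op N) (i j : Fin (N + 1)) :
    measureMap φ₀ ϑ o A i j = (amp φ₀ ϑ o i * amp φ₀ ϑ o j : ℝ) * A i j := by
  have h : (measOp φ₀ ϑ o : Op N)ᴴ = measOp φ₀ ϑ o := by
    rw [measOp_eq, Matrix.diagonal_conjTranspose]
    congr 1
    ext n
    simp
  rw [measureMap, h, measOp_eq, Matrix.mul_diagonal, Matrix.diagonal_mul]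
  push_cast
  ring

theorem measureMap_posSemidef (o : Outcome) {A : Op N} (hA : A.PosSemidef) :
    (measureMap φ₀ ϑ o A).PosSemidef :=
  hA.mul_mul_conjTranspose_same _

theorem measureMap_add (o : Outcome) (A B : Op N) :
    measureMap φ₀ ϑ o (A + B) = measureMap φ₀ ϑ o A + measureMap φ₀ ϑ o B := by
  simp [measureMap, mul_add, add_mul]

theorem measureMap_smul (o : Outcome) (c : ℂ) (A : Op N) :
    measureMap φ₀ ϑ o (c • A) = c • measureMap φ₀ ϑ o A := by
  simp [measureMap]

theorem continuous_measureMap (o : Outcome) :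
    Continuous (measureMap φ₀ ϑ o : Op N → Op N) := by
  unfold measureMap; fun_prop

theorem measureMap_add_apply_self (A : Op N) (i : Fin (N + 1)) :
    (measureMap φ₀ ϑ Outcome.g A + measureMap φ₀ ϑ Outcome.e A) i i = A i i := by
  rw [Matrix.add_apply, measureMap_apply, measureMap_apply, ← add_mul, ← Complex.ofReal_add,
    ← sq, ← sq, amp_g_sq_add_amp_e_sq, Complex.ofReal_one, one_mul]

theorem trace_measureMap_add (A : Op N) :
    (measureMap φ₀ ϑ Outcome.g A).trace + (measureMap φ₀ ϑ Outcome.e A).trace = A.trace := by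
  rw [← Matrix.trace_add]
  exact Finset.sum_congr rfl fun i _ => measureMap_add_apply_self φ₀ ϑ A i

theorem re_trace_measureMap (o : Outcome) (A : Op N) :
    (measureMap φ₀ ϑ o A).trace.re = ∑ i : Fin (N + 1), amp φ₀ ϑ o i ^ 2 * (A i i).re := by
  rw [Matrix.trace, Complex.re_sum]
  refine Finset.sum_congr rfl fun i _ => ?_
  rw [Matrix.diag_apply, measureMap_apply, Complex.re_ofReal_mul, sq]

theorem kraus_posSemidef (α : ℂ) {A : Op N} (hA : A.PosSemidef) :
    (kraus φ₀ ϑ α A).PosSemidef :=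
  (measureMap_posSemidef φ₀ ϑ _ (displace_posSemidef α hA)).add
    (measureMap_posSemidef φ₀ ϑ _ (displace_posSemidef α hA))

theorem trace_kraus (α : ℂ) (A : Op N) : (kraus φ₀ ϑ α A).trace = A.trace := by
  rw [kraus, Matrix.trace_add, trace_measureMap_add, trace_displace]

/-- The measurement does not demolish the Fock states: averaged over the outcomes it leaves their
populations unchanged. -/
theorem fidelity_kraus (n : Fin (N + 1)) (α : ℂ) (A : Op N) :
    fidelity n (kraus φ₀ ϑ α A) = fidelity n (displace α A) := by
  rw [fidelity_eq, fidelity_eq, kraus, measureMap_add_apply_self]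

theorem kraus_add (α : ℂ) (A B : Op N) :
    kraus φ₀ ϑ α (A + B) = kraus φ₀ ϑ α A + kraus φ₀ ϑ α B := by
  simp only [kraus, displace_add, measureMap_add]
  abel

theorem kraus_smul (α c : ℂ) (A : Op N) : kraus φ₀ ϑ α (c • A) = c • kraus φ₀ ϑ α A := by
  simp only [kraus, displace_smul, measureMap_smul, smul_add]

theorem continuous_kraus {X : Type*} [TopologicalSpace X] {f : X → ℂ} {g : X → Op N}
    (hf : Continuous f) (hg : Continuous g) : Continuous fun x => kraus φ₀ ϑ (f x) (g x) :=
  ((continuous_measureMap φ₀ ϑ _).comp (continuous_displace hf hg)).add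
    ((continuous_measureMap φ₀ ϑ _).comp (continuous_displace hf hg))

theorem foldr_kraus_posSemidef (l : List ℂ) {A : Op N} (hA : A.PosSemidef) :
    (l.foldr (kraus φ₀ ϑ) A).PosSemidef := by
  induction l with
  | nil => exact hA
  | cons α l ih => exact kraus_posSemidef φ₀ ϑ α ih

theorem trace_foldr_kraus (l : List ℂ) (A : Op N) :
    (l.foldr (kraus φ₀ ϑ) A).trace = A.trace := by
  induction l with
  | nil => rfl
  | cons α l ih => rw [List.foldr_cons, trace_kraus, ih]

theorem foldr_kraus_add (l : List ℂ) (A B : Op N) :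
    l.foldr (kraus φ₀ ϑ) (A + B) = l.foldr (kraus φ₀ ϑ) A + l.foldr (kraus φ₀ ϑ) B := by
  induction l with
  | nil => rfl
  | cons α l ih => simp only [List.foldr_cons, ih, kraus_add]

theorem foldr_kraus_smul (l : List ℂ) (c : ℂ) (A : Op N) :
    l.foldr (kraus φ₀ ϑ) (c • A) = c • l.foldr (kraus φ₀ ϑ) A := by
  induction l with
  | nil => rfl
  | cons α l ih => simp only [List.foldr_cons, ih, kraus_smul]

theorem continuous_foldr_kraus {X : Type*} [TopologicalSpace X] {k : ℕ} {f : X → Fin k → ℂ}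
    {g : X → Op N} (hf : Continuous f) (hg : Continuous g) :
    Continuous fun x => (List.ofFn (f x)).foldr (kraus φ₀ ϑ) (g x) := by
  induction k with
  | zero => simpa using hg
  | succ k ih =>
    simp only [List.ofFn_succ, List.foldr_cons]
    exact continuous_kraus φ₀ ϑ ((continuous_apply 0).comp hf)
      (ih (f := fun x i => f x i.succ) (by fun_prop))

theorem fidelity_foldr_kraus_zero (n : Fin (N + 1)) (k : ℕ) (A : Op N) :
    fidelity n ((List.ofFn (0 : Fin k → ℂ)).foldr (kraus φ₀ ϑ) A) = fidelity n A := by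
  induction k with
  | zero => simp
  | succ k ih =>
    rw [List.ofFn_succ, List.foldr_cons, fidelity_kraus, Pi.zero_apply, displace_zero]
    exact ih

theorem pred_posSemidef {χ : State N m} (hχ : χ.1.PosSemidef) : (pred φ₀ ϑ χ).PosSemidef :=
  foldr_kraus_posSemidef φ₀ ϑ _ hχ

theorem pred_mem_densityMatrices {χ : State N m} (hχ : χ.1 ∈ densityMatrices N) :
    pred φ₀ ϑ χ ∈ densityMatrices N :=
  ⟨pred_posSemidef φ₀ ϑ hχ.1, (trace_foldr_kraus φ₀ ϑ _ _).trans hχ.2⟩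

theorem predOutcome_posSemidef (o : Outcome) {χ : State N m} (hχ : χ.1.PosSemidef) :
    (predOutcome φ₀ ϑ o χ).PosSemidef :=
  foldr_kraus_posSemidef φ₀ ϑ _ (measureMap_posSemidef φ₀ ϑ o (displace_posSemidef _ hχ))

theorem re_trace_predOutcome (o : Outcome) (χ : State N m) :
    (predOutcome φ₀ ϑ o χ).trace.re = outcomeProb φ₀ ϑ o χ := by
  rw [predOutcome, trace_foldr_kraus, outcomeProb]

theorem predOutcome_add (χ : State N m) :
    predOutcome φ₀ ϑ Outcome.g χ + predOutcome φ₀ ϑ Outcome.e χ = pred φ₀ ϑ χ := by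
  rw [predOutcome, predOutcome, ← foldr_kraus_add, pred, List.ofFn_succ', List.concat_eq_append,
    List.foldr_append]
  rfl

theorem continuous_pred : Continuous (pred φ₀ ϑ : State N m → Op N) :=
  continuous_foldr_kraus φ₀ ϑ continuous_snd continuous_fst

theorem continuous_measureMap_displace (o : Outcome) : Continuous fun χ : State N m =>
    measureMap φ₀ ϑ o (displace (χ.2 (Fin.last m)) χ.1) :=
  (continuous_measureMap φ₀ ϑ o).comp
    (continuous_displace ((continuous_apply (Fin.last m)).comp continuous_snd) continuous_fst)

theorem continuous_predOutcome (o : Outcome) :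
    Continuous (predOutcome φ₀ ϑ o : State N m → Op N) :=
  continuous_foldr_kraus φ₀ ϑ (f := fun χ : State N m => Fin.init χ.2)
    (by unfold Fin.init; fun_prop) (continuous_measureMap_displace φ₀ ϑ o)

theorem continuous_outcomeProb (o : Outcome) :
    Continuous (outcomeProb φ₀ ϑ o : State N m → ℝ) :=
  Complex.continuous_re.comp (continuous_measureMap_displace φ₀ ϑ o).matrix_trace

theorem outcomeProb_add {χ : State N m} (hχ : χ.1 ∈ densityMatrices N) :
    outcomeProb φ₀ ϑ Outcome.g χ + outcomeProb φ₀ ϑ Outcome.e χ = 1 := by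
  rw [outcomeProb, outcomeProb, ← Complex.add_re, trace_measureMap_add, trace_displace, hχ.2,
    Complex.one_re]

/-- Observing the outcome `o` conditions the prediction on that outcome. -/
theorem pred_step (χ : State N m) (α : ℂ) (o : Outcome) :
    pred φ₀ ϑ (step φ₀ ϑ χ α o) =
      (measureMap φ₀ ϑ o (displace (χ.2 (Fin.last m)) χ.1)).trace⁻¹ •
        kraus φ₀ ϑ α (predOutcome φ₀ ϑ o χ) := by
  rw [pred, step, predOutcome, List.ofFn_succ, List.foldr_cons]
  simp only [Fin.cons_zero, Fin.cons_succ]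
  rw [jump, foldr_kraus_smul, kraus_smul]

end

/-! ### Consequences of the assumptions on the parameters -/

section

variable {N m : ℕ} {φ₀ ϑ : ℝ}

theorem Admissible.amp_ne_zero (hadm : Admissible N φ₀ ϑ) (o : Outcome) (i : Fin (N + 1)) :
    amp φ₀ ϑ o i ≠ 0 := by
  have h := (hadm o).1
  rw [measOp_eq, Matrix.isUnit_diagonal, Pi.isUnit_iff] at h
  simpa using h i

theorem Admissible.amp_sq_injective (hadm : Admissible N φ₀ ϑ) (o : Outcome) :
    Function.Injective fun i : Fin (N + 1) => amp φ₀ ϑ o i ^ 2 := by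
  have h := (hadm o).2
  have hd : (measOp φ₀ ϑ o : Op N)ᴴ * measOp φ₀ ϑ o =
      Matrix.diagonal fun i : Fin (N + 1) => ((amp φ₀ ϑ o i ^ 2 : ℝ) : ℂ) := by
    rw [measOp_eq, Matrix.diagonal_conjTranspose, Matrix.diagonal_mul_diagonal]
    congr 1
    ext i
    simp [sq]
  rw [NondegenerateSpectrum, hd, Matrix.charpoly_diagonal, Polynomial.roots_prod _ _
    (Finset.prod_ne_zero_iff.2 fun i _ => Polynomial.X_sub_C_ne_zero _)] at h
  simp only [Polynomial.roots_X_sub_C, Multiset.bind_singleton] at h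
  intro i j hij
  refine Multiset.inj_on_of_nodup_map h i (Finset.mem_univ i) j (Finset.mem_univ j) ?_
  exact congrArg _ hij

/-- The outcome probabilities are bounded away from `0`, uniformly over all states. -/
theorem Admissible.exists_le_outcomeProb (hadm : Admissible N φ₀ ϑ) :
    ∃ c > (0 : ℝ), ∀ (o : Outcome) (χ : State N m), χ.1 ∈ densityMatrices N →
      c ≤ outcomeProb φ₀ ϑ o χ := by
  have hmin : ∀ o, ∃ c > (0 : ℝ), ∀ i : Fin (N + 1), c ≤ amp φ₀ ϑ o i ^ 2 := fun o => by
    obtain ⟨i, hi⟩ := Finite.exists_min fun i : Fin (N + 1) => amp φ₀ ϑ o i ^ 2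
    exact ⟨_, by have := hadm.amp_ne_zero o i; positivity, hi⟩
  choose c hc0 hc using hmin
  refine ⟨min (c Outcome.g) (c Outcome.e), lt_min (hc0 _) (hc0 _), fun o χ hχ => ?_⟩
  have hle : min (c Outcome.g) (c Outcome.e) ≤ c o := by
    cases o
    exacts [min_le_left _ _, min_le_right _ _]
  refine hle.trans ?_
  have htr : ∑ i, (displace (χ.2 (Fin.last m)) χ.1 i i).re = 1 := by
    rw [← Complex.re_sum]
    change (displace (χ.2 (Fin.last m)) χ.1).trace.re = 1
    rw [trace_displace, hχ.2, Complex.one_re]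
  rw [outcomeProb, re_trace_measureMap, ← mul_one (c o), ← htr, Finset.mul_sum]
  exact Finset.sum_le_sum fun i _ => mul_le_mul_of_nonneg_right (hc o i)
    (re_diag_nonneg (displace_posSemidef _ hχ.1) i)

theorem Admissible.outcomeProb_pos (hadm : Admissible N φ₀ ϑ) (o : Outcome) {χ : State N m}
    (hχ : χ.1 ∈ densityMatrices N) : 0 < outcomeProb φ₀ ϑ o χ := by
  obtain ⟨c, hc, h⟩ := hadm.exists_le_outcomeProb (m := m)
  exact hc.trans_le (h o χ hχ)

theorem outcomeProb_le_one (hadm : Admissible N φ₀ ϑ) (o : Outcome) {χ : State N m}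
    (hχ : χ.1 ∈ densityMatrices N) : outcomeProb φ₀ ϑ o χ ≤ 1 := by
  have h := outcomeProb_add φ₀ ϑ hχ
  have hg := hadm.outcomeProb_pos Outcome.g hχ
  have he := hadm.outcomeProb_pos Outcome.e hχ
  cases o <;> linarith

theorem step_mem_densityMatrices (hadm : Admissible N φ₀ ϑ) {χ : State N m}
    (hχ : χ.1 ∈ densityMatrices N) (α : ℂ) (o : Outcome) :
    (step φ₀ ϑ χ α o).1 ∈ densityMatrices N :=
  inv_smul_mem_densityMatrices (measureMap_posSemidef φ₀ ϑ o (displace_posSemidef _ hχ.1))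
    (hadm.outcomeProb_pos o hχ)

theorem fidelity_smul_ofReal (n : Fin (N + 1)) (c : ℝ) (A : Op N) :
    fidelity n ((c : ℂ) • A) = c * fidelity n A := by
  rw [fidelity_eq, fidelity_eq, Matrix.smul_apply, smul_eq_mul, Complex.re_ofReal_mul]

theorem fidelity_pred_step {χ : State N m} (hχ : χ.1 ∈ densityMatrices N) (n : Fin (N + 1)) (α : ℂ)
    (o : Outcome) : fidelity n (pred φ₀ ϑ (step φ₀ ϑ χ α o)) =
      fidelity n (displace α (predOutcome φ₀ ϑ o χ)) / outcomeProb φ₀ ϑ o χ := by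
  rw [pred_step, ← ofReal_re_trace (measureMap_posSemidef φ₀ ϑ o (displace_posSemidef _ hχ.1)),
    ← Complex.ofReal_inv, fidelity_smul_ofReal, fidelity_kraus, outcomeProb, div_eq_inv_mul]

theorem fidelity_displace_predOutcome_add (χ : State N m) (n : Fin (N + 1)) (α : ℂ) :
    fidelity n (displace α (predOutcome φ₀ ϑ Outcome.g χ)) +
      fidelity n (displace α (predOutcome φ₀ ϑ Outcome.e χ)) =
      fidelity n (displace α (pred φ₀ ϑ χ)) := by
  rw [← predOutcome_add, displace_add]
  simp only [fidelity_eq, Matrix.add_apply, Complex.add_re]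

theorem fidelity_displace_predOutcome_nonneg {χ : State N m} (hχ : χ.1 ∈ densityMatrices N)
    (n : Fin (N + 1)) (α : ℂ) (o : Outcome) :
    0 ≤ fidelity n (displace α (predOutcome φ₀ ϑ o χ)) :=
  fidelity_nonneg (displace_posSemidef α (predOutcome_posSemidef φ₀ ϑ o hχ.1)) n

theorem fidelity_displace_predOutcome_le {χ : State N m} (hχ : χ.1 ∈ densityMatrices N)
    (n : Fin (N + 1)) (α : ℂ) (o : Outcome) :
    fidelity n (displace α (predOutcome φ₀ ϑ o χ)) ≤ outcomeProb φ₀ ϑ o χ := by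
  have := fidelity_le_trace (displace_posSemidef α (predOutcome_posSemidef φ₀ ϑ o hχ.1)) n
  rwa [trace_displace, re_trace_predOutcome] at this

theorem fidelity_pred_nonneg {χ : State N m} (hχ : χ.1 ∈ densityMatrices N) (n : Fin (N + 1)) :
    0 ≤ fidelity n (pred φ₀ ϑ χ) :=
  fidelity_nonneg (pred_posSemidef φ₀ ϑ hχ.1) n

theorem fidelity_pred_le_one {χ : State N m} (hχ : χ.1 ∈ densityMatrices N) (n : Fin (N + 1)) :
    fidelity n (pred φ₀ ϑ χ) ≤ 1 := by
  have h := pred_mem_densityMatrices φ₀ ϑ hχ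
  have := fidelity_le_trace h.1 n
  rwa [h.2, Complex.one_re] at this

/-! ### The Lyapunov function and its drift -/

/-- The maximising displacement brings the predicted fidelity above a fixed level, whatever the
state and the outcome. -/
theorem exists_le_fidelity_displace_of_max (hadm : Admissible N φ₀ ϑ) (n : Fin (N + 1))
    {αbar : ℝ} (hα : 0 < αbar) :
    ∃ δ > (0 : ℝ), ∀ χ : State N m, χ.1 ∈ densityMatrices N → ∀ α : ℂ,
      (∀ α' : ℂ, ‖α'‖ ≤ αbar →
        fidelity n (displace α' (predOutcome φ₀ ϑ Outcome.g χ)) *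
            fidelity n (displace α' (predOutcome φ₀ ϑ Outcome.e χ)) ≤
          fidelity n (displace α (predOutcome φ₀ ϑ Outcome.g χ)) *
            fidelity n (displace α (predOutcome φ₀ ϑ Outcome.e χ))) →
      ∀ o, δ ≤ fidelity n (displace α (predOutcome φ₀ ϑ o χ)) := by
  obtain ⟨c, hc, hcp⟩ := hadm.exists_le_outcomeProb (m := m)
  obtain ⟨δ, hδ, h⟩ := exists_uniform_displace_fidelity n hα
  refine ⟨c * c * δ, by positivity, fun χ hχ α hmax => ?_⟩
  -- normalise the two conditional predictions
  have hnorm : ∀ o, ∃ A ∈ densityMatrices N,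
      predOutcome φ₀ ϑ o χ = ((outcomeProb φ₀ ϑ o χ : ℝ) : ℂ) • A := by
    intro o
    have hpsd := predOutcome_posSemidef φ₀ ϑ o hχ.1
    have hpos := hadm.outcomeProb_pos o hχ
    rw [← re_trace_predOutcome] at hpos
    refine ⟨_, inv_smul_mem_densityMatrices hpsd hpos, ?_⟩
    rw [← re_trace_predOutcome, ofReal_re_trace hpsd, smul_inv_smul₀]
    intro h0
    simp [h0] at hpos
  obtain ⟨A, hA, hAe⟩ := hnorm Outcome.g
  obtain ⟨B, hB, hBe⟩ := hnorm Outcome.e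
  obtain ⟨α', hα', hδ'⟩ := h A hA B hB
  have hprod := hmax α' hα'
  have hlow : c * c * δ ≤ fidelity n (displace α' (predOutcome φ₀ ϑ Outcome.g χ)) *
      fidelity n (displace α' (predOutcome φ₀ ϑ Outcome.e χ)) := by
    rw [hAe, hBe, displace_smul, displace_smul, fidelity_smul_ofReal, fidelity_smul_ofReal,
      mul_mul_mul_comm]
    exact mul_le_mul (mul_le_mul (hcp _ χ hχ) (hcp _ χ hχ) hc.le (hadm.outcomeProb_pos _ hχ).le)
      hδ' hδ.le (mul_nonneg (hadm.outcomeProb_pos _ hχ).le (hadm.outcomeProb_pos _ hχ).le)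
  have hone : ∀ o, fidelity n (displace α (predOutcome φ₀ ϑ o χ)) ≤ 1 := fun o =>
    (fidelity_displace_predOutcome_le hχ n α o).trans (outcomeProb_le_one hadm o hχ)
  have hnn : ∀ o, 0 ≤ fidelity n (displace α (predOutcome φ₀ ϑ o χ)) := fun o =>
    fidelity_displace_predOutcome_nonneg hχ n α o
  intro o
  cases o
  · exact (hlow.trans hprod).trans (mul_le_of_le_one_right (hnn _) (hone _))
  · exact (hlow.trans hprod).trans (mul_le_of_le_one_left (hnn _) (hone _))

variable (φ₀ ϑ) (n : Fin (N + 1)) (ε η : ℝ)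

/-- The control `ε tr (|n⟩⟨n| [ρ^pred, a])`, used when the predicted fidelity is at least `η`. -/
def gradientControl (χ : State N m) : ℂ := (ε : ℂ) * fidelityGradient n (pred φ₀ ϑ χ)

/-- The amount `q_g p_e - q_e p_g`, where `p_o` is the probability of the outcome `o` and
`q_o / p_o` is the predicted fidelity after that outcome under the control `α`. It vanishes when
the two outcomes give the same predicted fidelity. -/
def spread (α : ℂ) (χ : State N m) : ℝ :=
  fidelity n (displace α (predOutcome φ₀ ϑ Outcome.g χ)) * outcomeProb φ₀ ϑ Outcome.e χ -
    fidelity n (displace α (predOutcome φ₀ ϑ Outcome.e χ)) * outcomeProb φ₀ ϑ Outcome.g χ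

/-- The Lyapunov function `V + V ^ 2`, where `V` is the predicted fidelity. The quadratic term makes
the drift detect the spread of the two outcomes. -/
def lyapunov (χ : State N m) : ℝ := fidelity n (pred φ₀ ϑ χ) + fidelity n (pred φ₀ ϑ χ) ^ 2

/-- A lower bound for the mean increase of `lyapunov` in one step of the closed loop. -/
def drift (χ : State N m) : ℝ :=
  if η ≤ fidelity n (pred φ₀ ϑ χ) then
    ε * ‖fidelityGradient n (pred φ₀ ϑ χ)‖ ^ 2 + spread φ₀ ϑ n (gradientControl φ₀ ϑ n ε χ) χ ^ 2
  else η

/-- A lower bound, depending measurably on the state, for the value of `lyapunov` after the outcome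
`o`. When the predicted fidelity is below `η` the control is an arbitrary, possibly non-measurable,
choice among maximisers, and only the constant `2 η` for the next fidelity is retained. -/
def lyapunovNext (o : Outcome) (χ : State N m) : ℝ :=
  if η ≤ fidelity n (pred φ₀ ϑ χ) then
    fidelity n (displace (gradientControl φ₀ ϑ n ε χ) (predOutcome φ₀ ϑ o χ)) /
        outcomeProb φ₀ ϑ o χ +
      (fidelity n (displace (gradientControl φ₀ ϑ n ε χ) (predOutcome φ₀ ϑ o χ)) /
        outcomeProb φ₀ ϑ o χ) ^ 2
  else 2 * η + (2 * η) ^ 2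

variable {φ₀ ϑ n ε η}

theorem lyapunov_nonneg {χ : State N m} (hχ : χ.1 ∈ densityMatrices N) :
    0 ≤ lyapunov φ₀ ϑ n χ := by
  have := fidelity_pred_nonneg (φ₀ := φ₀) (ϑ := ϑ) hχ n
  unfold lyapunov
  positivity

theorem lyapunov_le_two {χ : State N m} (hχ : χ.1 ∈ densityMatrices N) :
    lyapunov φ₀ ϑ n χ ≤ 2 := by
  have h0 := fidelity_pred_nonneg (φ₀ := φ₀) (ϑ := ϑ) hχ n
  have h1 := fidelity_pred_le_one (φ₀ := φ₀) (ϑ := ϑ) hχ n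
  unfold lyapunov
  nlinarith

theorem drift_nonneg (hε : 0 < ε) (hη : 0 < η) (χ : State N m) : 0 ≤ drift φ₀ ϑ n ε η χ := by
  unfold drift
  split_ifs <;> positivity

theorem lyapunovNext_nonneg (hη : 0 < η) (hadm : Admissible N φ₀ ϑ) (o : Outcome) {χ : State N m}
    (hχ : χ.1 ∈ densityMatrices N) : 0 ≤ lyapunovNext φ₀ ϑ n ε η o χ := by
  unfold lyapunovNext
  split_ifs
  · have := div_nonneg (fidelity_displace_predOutcome_nonneg (φ₀ := φ₀) (ϑ := ϑ) hχ n
      (gradientControl φ₀ ϑ n ε χ) o) (hadm.outcomeProb_pos o hχ).le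
    positivity
  · positivity

theorem lyapunovNext_le_two (hη : 0 < η) (hη' : η ≤ 1 / 2) (hadm : Admissible N φ₀ ϑ) (o : Outcome)
    {χ : State N m} (hχ : χ.1 ∈ densityMatrices N) : lyapunovNext φ₀ ϑ n ε η o χ ≤ 2 := by
  unfold lyapunovNext
  split_ifs
  · have h0 := div_nonneg (fidelity_displace_predOutcome_nonneg (φ₀ := φ₀) (ϑ := ϑ) hχ n
      (gradientControl φ₀ ϑ n ε χ) o) (hadm.outcomeProb_pos o hχ).le
    have h1 := div_le_one_of_le₀ (fidelity_displace_predOutcome_le (φ₀ := φ₀) (ϑ := ϑ) hχ n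
      (gradientControl φ₀ ϑ n ε χ) o) (hadm.outcomeProb_pos o hχ).le
    nlinarith
  · nlinarith

/-- The mean of `lyapunovNext` over the two outcomes exceeds the current value of `lyapunov` by at
least `drift`. -/
theorem lyapunov_add_drift_le (hadm : Admissible N φ₀ ϑ) (hη : 0 < η)
    (hgain : ∀ A ∈ densityMatrices N, fidelity n A + ε * ‖fidelityGradient n A‖ ^ 2 ≤
      fidelity n (displace ((ε : ℂ) * fidelityGradient n A) A)) (hε : 0 < ε)
    {χ : State N m} (hχ : χ.1 ∈ densityMatrices N) :
    lyapunov φ₀ ϑ n χ + drift φ₀ ϑ n ε η χ ≤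
      outcomeProb φ₀ ϑ Outcome.g χ * lyapunovNext φ₀ ϑ n ε η Outcome.g χ +
        outcomeProb φ₀ ϑ Outcome.e χ * lyapunovNext φ₀ ϑ n ε η Outcome.e χ := by
  have hsum := outcomeProb_add φ₀ ϑ hχ
  have hV := fidelity_pred_nonneg (φ₀ := φ₀) (ϑ := ϑ) hχ n
  unfold lyapunov drift lyapunovNext
  split_ifs with h
  · have hp := hadm.outcomeProb_pos Outcome.g hχ
    have hp' := hadm.outcomeProb_pos Outcome.e hχ
    have hmean := fidelity_displace_predOutcome_add (φ₀ := φ₀) (ϑ := ϑ) χ n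
      (gradientControl φ₀ ϑ n ε χ)
    have hg := hgain _ (pred_mem_densityMatrices φ₀ ϑ hχ)
    rw [← gradientControl, ← hmean] at hg
    unfold spread
    set q := fidelity n (displace (gradientControl φ₀ ϑ n ε χ) (predOutcome φ₀ ϑ Outcome.g χ))
    set q' := fidelity n (displace (gradientControl φ₀ ϑ n ε χ) (predOutcome φ₀ ϑ Outcome.e χ))
    set p := outcomeProb φ₀ ϑ Outcome.g χ
    set p' := outcomeProb φ₀ ϑ Outcome.e χ
    set V := fidelity n (pred φ₀ ϑ χ)
    have hvar := sq_add_sq_le_sq_div_add_sq_div (q := q) (q' := q') hp hp' hsum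
    have hVq : V ≤ q + q' := le_trans (by
      have := mul_nonneg hε.le (sq_nonneg ‖fidelityGradient n (pred φ₀ ϑ χ)‖)
      linarith) hg
    have hsq : V ^ 2 ≤ (q + q') ^ 2 := pow_le_pow_left₀ hV hVq 2
    have e1 : p * (q / p + (q / p) ^ 2) = q + q ^ 2 / p := by field_simp
    have e2 : p' * (q' / p' + (q' / p') ^ 2) = q' + q' ^ 2 / p' := by field_simp
    rw [e1, e2]
    linarith
  · push Not at h
    rw [← add_mul, hsum, one_mul]
    nlinarith

/-- `lyapunovNext` is a lower bound for `lyapunov` after one step under any value allowed by the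
feedback law. -/
theorem lyapunovNext_le {αbar δ : ℝ} (hadm : Admissible N φ₀ ϑ)
    (hδ : ∀ χ : State N m, χ.1 ∈ densityMatrices N → ∀ α : ℂ,
      (∀ α' : ℂ, ‖α'‖ ≤ αbar →
        fidelity n (displace α' (predOutcome φ₀ ϑ Outcome.g χ)) *
            fidelity n (displace α' (predOutcome φ₀ ϑ Outcome.e χ)) ≤
          fidelity n (displace α (predOutcome φ₀ ϑ Outcome.g χ)) *
            fidelity n (displace α (predOutcome φ₀ ϑ Outcome.e χ))) →
      ∀ o, δ ≤ fidelity n (displace α (predOutcome φ₀ ϑ o χ)))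
    (hη : 0 < η) (hηδ : 2 * η ≤ δ) {χ : State N m} (hχ : χ.1 ∈ densityMatrices N) {α : ℂ}
    (hα : IsFeedbackValue φ₀ ϑ n αbar ε η χ α) (o : Outcome) :
    lyapunovNext φ₀ ϑ n ε η o χ ≤ lyapunov φ₀ ϑ n (step φ₀ ϑ χ α o) := by
  rw [lyapunov, fidelity_pred_step hχ]
  unfold lyapunovNext
  split_ifs with h
  · have : α = gradientControl φ₀ ϑ n ε χ := hα.1 h
    rw [this]
  · have hle := hηδ.trans (hδ χ hχ α (hα.2 (not_le.1 h)).2 o)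
    have hp := hadm.outcomeProb_pos o hχ
    have hdiv := le_div_self ((by positivity : 0 ≤ 2 * η).trans hle) hp
      (outcomeProb_le_one hadm o hχ)
    have := hle.trans hdiv
    gcongr

end

/-! ### Almost sure consequences of the drift -/

/-- If a bounded sequence of random variables has mean increments at least `𝔼 [L_k]`, with `L_k`
nonnegative, then `∑ L_k` is almost surely finite and `L_k → 0`. -/
theorem ae_tendsto_zero_of_integral_add_le {Ω : Type*} {mΩ : MeasurableSpace Ω} {μ : Measure Ω}
    {L : ℕ → Ω → ℝ} {w : ℕ → ℝ} {C : ℝ} (hw : ∀ k, w k ≤ C) (hL : ∀ k ω, 0 ≤ L k ω)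
    (hLi : ∀ k, Integrable (L k) μ) (h : ∀ k, w k + ∫ ω, L k ω ∂μ ≤ w (k + 1)) :
    ∀ᵐ ω ∂μ, Tendsto (fun k => L k ω) atTop (𝓝 0) := by
  have hpart : ∀ n, w 0 + ∑ k ∈ Finset.range n, ∫ ω, L k ω ∂μ ≤ w n := by
    intro n
    induction n with
    | zero => simp
    | succ n ih =>
      rw [Finset.sum_range_succ]
      linarith [h n]
  have hsum : Summable fun k => ∫ ω, L k ω ∂μ :=
    summable_of_sum_range_le (c := C - w 0) (fun k => integral_nonneg (hL k)) fun n => by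
      linarith [hpart n, hw n]
  have hlin : ∫⁻ ω, ∑' k, ENNReal.ofReal (L k ω) ∂μ ≠ ⊤ := by
    rw [lintegral_tsum fun k => (hLi k).aemeasurable.ennreal_ofReal]
    have : ∀ k, ∫⁻ ω, ENNReal.ofReal (L k ω) ∂μ = ENNReal.ofReal (∫ ω, L k ω ∂μ) := fun k =>
      (ofReal_integral_eq_lintegral_ofReal (hLi k) (Eventually.of_forall (hL k))).symm
    simp_rw [this]
    exact hsum.tsum_ofReal_ne_top
  have hmeas : AEMeasurable (fun ω => ∑' k, ENNReal.ofReal (L k ω)) μ :=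
    AEMeasurable.tsum fun k => (hLi k).aemeasurable.ennreal_ofReal
  filter_upwards [ae_lt_top' hmeas hlin] with ω hω
  have h0 := ENNReal.tendsto_atTop_zero_of_tsum_ne_top hω.ne
  have h1 := (ENNReal.tendsto_toReal ENNReal.zero_ne_top).comp h0
  simpa [Function.comp_def, ENNReal.toReal_ofReal (hL _ ω)] using h1

section

variable {N m : ℕ} {φ₀ ϑ : ℝ} {u : State N m → ℂ} {χ₀ : State N m} {Ω : Type*}
  {mΩ : MeasurableSpace Ω} {μ : Measure Ω} {ℱ : Filtration ℕ mΩ} {χ : ℕ → Ω → State N m}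
  {s : ℕ → Ω → Outcome}

theorem IsClosedLoopChain.mem_densityMatrices (hadm : Admissible N φ₀ ϑ)
    (hχ₀ : χ₀.1 ∈ densityMatrices N) (h : IsClosedLoopChain φ₀ ϑ u χ₀ μ ℱ χ s) (k : ℕ) (ω : Ω) :
    (χ k ω).1 ∈ densityMatrices N := by
  induction k with
  | zero => rwa [h.init]
  | succ k ih =>
    rw [h.step_eq]
    exact step_mem_densityMatrices hadm ih _ _

/-- Averaging over the outcome `s k` replaces its indicator by the outcome probability. -/
theorem IsClosedLoopChain.integral_indicator_mul [IsProbabilityMeasure μ]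
    (h : IsClosedLoopChain φ₀ ϑ u χ₀ μ ℱ χ s) (k : ℕ) (o : Outcome) {F : Ω → ℝ} {C : ℝ}
    (hF : StronglyMeasurable[ℱ k] F) (hC : ∀ ω, ‖F ω‖ ≤ C) :
    ∫ ω, F ω * Set.indicator {ω | s k ω = o} (fun _ => (1 : ℝ)) ω ∂μ =
      ∫ ω, F ω * outcomeProb φ₀ ϑ o (χ k ω) ∂μ := by
  have hle : ℱ k ≤ mΩ := ℱ.le k
  have hind : Integrable (Set.indicator {ω | s k ω = o} (fun _ => (1 : ℝ))) μ :=
    (integrable_const 1).indicator (ℱ.le (k + 1) _ (h.outcome_measurable k o))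
  have hpull := condExp_stronglyMeasurable_mul_of_bound hle (μ := μ) hF hind C
    (Eventually.of_forall hC)
  have hint := integral_condExp (μ := μ) hle
    (f := F * Set.indicator {ω | s k ω = o} (fun _ => (1 : ℝ)))
  refine (hint.symm.trans ?_)
  refine integral_congr_ae ?_
  filter_upwards [hpull, h.outcome_law k o] with ω h1 h2
  rw [h1, Pi.mul_apply, h2]

variable {n : Fin (N + 1)} {ε η : ℝ}

theorem continuous_gradientControl :
    Continuous (gradientControl φ₀ ϑ n ε : State N m → ℂ) :=
  continuous_const.mul ((continuous_gradient n).comp (continuous_pred φ₀ ϑ))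

theorem continuous_fidelity_displace_predOutcome (o : Outcome) :
    Continuous fun χ : State N m =>
      fidelity n (displace (gradientControl φ₀ ϑ n ε χ) (predOutcome φ₀ ϑ o χ)) :=
  (continuous_fidelity n).comp
    (continuous_displace continuous_gradientControl (continuous_predOutcome φ₀ ϑ o))

theorem continuous_spread :
    Continuous fun χ : State N m => spread φ₀ ϑ n (gradientControl φ₀ ϑ n ε χ) χ :=
  ((continuous_fidelity_displace_predOutcome _).mul (continuous_outcomeProb φ₀ ϑ _)).sub
    ((continuous_fidelity_displace_predOutcome _).mul (continuous_outcomeProb φ₀ ϑ _))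

theorem continuous_fidelity_pred :
    Continuous fun χ : State N m => fidelity n (pred φ₀ ϑ χ) :=
  (continuous_fidelity n).comp (continuous_pred φ₀ ϑ)

theorem stronglyMeasurable_drift {X : Type*} {mX : MeasurableSpace X} {f : X → State N m}
    (hf : StronglyMeasurable f) : StronglyMeasurable fun x => drift φ₀ ϑ n ε η (f x) := by
  unfold drift
  refine StronglyMeasurable.ite ?_ ?_ stronglyMeasurable_const
  · exact measurableSet_le measurable_const
      (continuous_fidelity_pred.comp_stronglyMeasurable hf).measurable
  · refine Continuous.comp_stronglyMeasurable (g := fun χ : State N m =>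
      ε * ‖fidelityGradient n (pred φ₀ ϑ χ)‖ ^ 2 +
        spread φ₀ ϑ n (gradientControl φ₀ ϑ n ε χ) χ ^ 2) ?_ hf
    exact (continuous_const.mul
      (((continuous_gradient n).comp (continuous_pred φ₀ ϑ)).norm.pow 2)).add
      (continuous_spread.pow 2)

theorem stronglyMeasurable_lyapunovNext {X : Type*} {mX : MeasurableSpace X} {f : X → State N m}
    (hf : StronglyMeasurable f) (o : Outcome) :
    StronglyMeasurable fun x => lyapunovNext φ₀ ϑ n ε η o (f x) := by
  unfold lyapunovNext
  refine StronglyMeasurable.ite ?_ ?_ stronglyMeasurable_const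
  · exact measurableSet_le measurable_const
      (continuous_fidelity_pred.comp_stronglyMeasurable hf).measurable
  · have hq := (continuous_fidelity_displace_predOutcome (φ₀ := φ₀) (ϑ := ϑ) (n := n) (ε := ε)
      o).comp_stronglyMeasurable hf
    have hp := (continuous_outcomeProb φ₀ ϑ o).comp_stronglyMeasurable hf
    have := (hq.measurable.div hp.measurable).stronglyMeasurable
    exact this.add (this.pow 2)

/-- Along the closed loop the drift tends to `0` almost surely. -/
theorem IsClosedLoopChain.ae_tendsto_drift [IsProbabilityMeasure μ] (hadm : Admissible N φ₀ ϑ)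
    (hχ₀ : χ₀.1 ∈ densityMatrices N) (h : IsClosedLoopChain φ₀ ϑ u χ₀ μ ℱ χ s)
    (hε : 0 < ε) (hη : 0 < η) (hη' : η ≤ 1 / 2)
    (hdrift : ∀ χ : State N m, χ.1 ∈ densityMatrices N →
      lyapunov φ₀ ϑ n χ + drift φ₀ ϑ n ε η χ ≤
        outcomeProb φ₀ ϑ Outcome.g χ * lyapunovNext φ₀ ϑ n ε η Outcome.g χ +
          outcomeProb φ₀ ϑ Outcome.e χ * lyapunovNext φ₀ ϑ n ε η Outcome.e χ)
    (hnext : ∀ χ : State N m, χ.1 ∈ densityMatrices N → ∀ o,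
      lyapunovNext φ₀ ϑ n ε η o χ ≤ lyapunov φ₀ ϑ n (step φ₀ ϑ χ (u χ) o)) :
    ∀ᵐ ω ∂μ, Tendsto (fun k => drift φ₀ ϑ n ε η (χ k ω)) atTop (𝓝 0) := by
  have hmem := h.mem_densityMatrices hadm hχ₀
  have hmeas : ∀ k, StronglyMeasurable (χ k) := fun k => (h.state_measurable k).mono (ℱ.le k)
  have hbdd : ∀ {f : Ω → ℝ}, StronglyMeasurable f → (∀ ω, 0 ≤ f ω) → (∀ ω, f ω ≤ 2) →
      Integrable f μ := fun hf h0 h2 =>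
    Integrable.of_bound hf.aestronglyMeasurable 2 (Eventually.of_forall fun ω => by
      rw [Real.norm_of_nonneg (h0 ω)]; exact h2 ω)
  have hWi : ∀ k, Integrable (fun ω => lyapunov φ₀ ϑ n (χ k ω)) μ := fun k =>
    hbdd ((continuous_fidelity_pred.add
      (continuous_fidelity_pred.pow 2)).comp_stronglyMeasurable (hmeas k))
      (fun ω => lyapunov_nonneg (hmem k ω)) (fun ω => lyapunov_le_two (hmem k ω))
  have hpi : ∀ k o, Integrable (fun ω => lyapunovNext φ₀ ϑ n ε η o (χ k ω) *
      outcomeProb φ₀ ϑ o (χ k ω)) μ := fun k o => by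
    have h0 : ∀ ω, 0 ≤ lyapunovNext φ₀ ϑ n ε η o (χ k ω) := fun ω =>
      lyapunovNext_nonneg hη hadm o (hmem k ω)
    refine hbdd ((stronglyMeasurable_lyapunovNext (hmeas k) o).mul
      ((continuous_outcomeProb φ₀ ϑ o).comp_stronglyMeasurable (hmeas k))) (fun ω => ?_)
      (fun ω => ?_)
    · exact mul_nonneg (h0 ω) (hadm.outcomeProb_pos o (hmem k ω)).le
    · exact (mul_le_of_le_one_right (h0 ω) (outcomeProb_le_one hadm o (hmem k ω))).trans
        (lyapunovNext_le_two hη hη' hadm o (hmem k ω))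
  have hsi : ∀ k o, Integrable (fun ω => lyapunovNext φ₀ ϑ n ε η o (χ k ω) *
      Set.indicator {ω | s k ω = o} (fun _ => (1 : ℝ)) ω) μ := fun k o => by
    have h0 : ∀ ω, 0 ≤ lyapunovNext φ₀ ϑ n ε η o (χ k ω) := fun ω =>
      lyapunovNext_nonneg hη hadm o (hmem k ω)
    have hset := ℱ.le (k + 1) _ (h.outcome_measurable k o)
    refine hbdd ((stronglyMeasurable_lyapunovNext (hmeas k) o).mul
      (stronglyMeasurable_const.indicator hset)) (fun ω => ?_) (fun ω => ?_)
    · exact mul_nonneg (h0 ω) (Set.indicator_nonneg (fun _ _ => zero_le_one) ω)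
    · exact (mul_le_of_le_one_right (h0 ω)
        (Set.indicator_le_self' (fun _ _ => zero_le_one) ω)).trans
        (lyapunovNext_le_two hη hη' hadm o (hmem k ω))
  have hdrift' : ∀ k ω, lyapunov φ₀ ϑ n (χ k ω) + drift φ₀ ϑ n ε η (χ k ω) ≤
      lyapunovNext φ₀ ϑ n ε η Outcome.g (χ k ω) * outcomeProb φ₀ ϑ Outcome.g (χ k ω) +
        lyapunovNext φ₀ ϑ n ε η Outcome.e (χ k ω) * outcomeProb φ₀ ϑ Outcome.e (χ k ω) :=
    fun k ω => (hdrift _ (hmem k ω)).trans_eq (by ring)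
  have hLi : ∀ k, Integrable (fun ω => drift φ₀ ϑ n ε η (χ k ω)) μ := fun k => by
    refine Integrable.mono' ((hpi k Outcome.g).add (hpi k Outcome.e))
      (stronglyMeasurable_drift (hmeas k)).aestronglyMeasurable (Eventually.of_forall fun ω => ?_)
    rw [Real.norm_of_nonneg (drift_nonneg hε hη _)]
    have := lyapunov_nonneg (φ₀ := φ₀) (ϑ := ϑ) (n := n) (hmem k ω)
    have := hdrift' k ω
    simp only [Pi.add_apply]
    linarith
  refine ae_tendsto_zero_of_integral_add_le (C := 2)
    (w := fun k => ∫ ω, lyapunov φ₀ ϑ n (χ k ω) ∂μ) (fun k => ?_)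
    (fun k ω => drift_nonneg hε hη _) hLi (fun k => ?_)
  · have := integral_mono (hWi k) (integrable_const 2) fun ω => lyapunov_le_two (hmem k ω)
    simpa using this
  · have hbound : ∀ o ω, ‖lyapunovNext φ₀ ϑ n ε η o (χ k ω)‖ ≤ 2 := fun o ω => by
      rw [Real.norm_of_nonneg (lyapunovNext_nonneg hη hadm o (hmem k ω))]
      exact lyapunovNext_le_two hη hη' hadm o (hmem k ω)
    have hswap : ∀ o, ∫ ω, lyapunovNext φ₀ ϑ n ε η o (χ k ω) *
        Set.indicator {ω | s k ω = o} (fun _ => (1 : ℝ)) ω ∂μ =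
        ∫ ω, lyapunovNext φ₀ ϑ n ε η o (χ k ω) * outcomeProb φ₀ ϑ o (χ k ω) ∂μ := fun o =>
      h.integral_indicator_mul k o
        (stronglyMeasurable_lyapunovNext (h.state_measurable k) o) (hbound o)
    calc ∫ ω, lyapunov φ₀ ϑ n (χ k ω) ∂μ + ∫ ω, drift φ₀ ϑ n ε η (χ k ω) ∂μ
        = ∫ ω, (lyapunov φ₀ ϑ n (χ k ω) + drift φ₀ ϑ n ε η (χ k ω)) ∂μ :=
          (integral_add (hWi k) (hLi k)).symm
      _ ≤ ∫ ω, (lyapunovNext φ₀ ϑ n ε η Outcome.g (χ k ω) * outcomeProb φ₀ ϑ Outcome.g (χ k ω) +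
          lyapunovNext φ₀ ϑ n ε η Outcome.e (χ k ω) * outcomeProb φ₀ ϑ Outcome.e (χ k ω)) ∂μ :=
          integral_mono ((hWi k).add (hLi k)) ((hpi k _).add (hpi k _)) (hdrift' k)
      _ = ∫ ω, (lyapunovNext φ₀ ϑ n ε η Outcome.g (χ k ω) *
            Set.indicator {ω | s k ω = Outcome.g} (fun _ => (1 : ℝ)) ω +
          lyapunovNext φ₀ ϑ n ε η Outcome.e (χ k ω) *
            Set.indicator {ω | s k ω = Outcome.e} (fun _ => (1 : ℝ)) ω) ∂μ := by
          rw [integral_add (hpi k _) (hpi k _), integral_add (hsi k _) (hsi k _), hswap, hswap]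
      _ ≤ ∫ ω, lyapunov φ₀ ϑ n (χ (k + 1) ω) ∂μ := by
          refine integral_mono ((hsi k _).add (hsi k _)) (hWi (k + 1)) fun ω => ?_
          have hstep := hnext _ (hmem k ω) (s k ω)
          rw [← h.step_eq] at hstep
          cases hs : s k ω <;> simpa [Set.indicator_apply, hs] using hstep

end

/-! ### Convergence along a trajectory -/

section

variable {N m : ℕ} {φ₀ ϑ : ℝ} {n : Fin (N + 1)} {ε η : ℝ}

/-- The probability of the outcome `g` when `A` is measured without displacement. -/
def probG (φ₀ ϑ : ℝ) (A : Op N) : ℝ := ∑ i : Fin (N + 1), amp φ₀ ϑ Outcome.g i ^ 2 * (A i i).re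

/-- A state for which the target Fock state cannot be distinguished from the state by the outcome
probabilities, neither now nor after one more detection, is the target: the second condition fixes
the second moment of `amp g ^ 2`, so that its variance around the value at the target vanishes. -/
theorem eq_fock_of_probG_eq (hadm : Admissible N φ₀ ϑ) {A : Op N} (hA : A ∈ densityMatrices N)
    (o : Outcome) (h : probG φ₀ ϑ A = amp φ₀ ϑ Outcome.g n ^ 2)
    (h' : probG φ₀ ϑ (jump φ₀ ϑ o A) = amp φ₀ ϑ Outcome.g n ^ 2) : A = fock n := by
  set c : Fin (N + 1) → ℝ := fun i => amp φ₀ ϑ Outcome.g i ^ 2 with hc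
  set a : Fin (N + 1) → ℝ := fun i => (A i i).re with ha
  have ha0 : ∀ i, 0 ≤ a i := re_diag_nonneg hA.1
  have hsum : ∑ i, a i = 1 := by
    have := congrArg Complex.re hA.2
    rwa [Matrix.trace, Complex.re_sum] at this
  have h1 : ∑ i, c i * a i = c n := h
  have he : ∀ i : Fin (N + 1), amp φ₀ ϑ Outcome.e i ^ 2 = 1 - c i := fun i => by
    have := amp_g_sq_add_amp_e_sq φ₀ ϑ i
    simp only [hc]
    linarith
  have htr := re_trace_measureMap φ₀ ϑ o A
  have hjump : probG φ₀ ϑ (jump φ₀ ϑ o A) =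
      (measureMap φ₀ ϑ o A).trace.re⁻¹ * ∑ i, c i * (amp φ₀ ϑ o i ^ 2 * a i) := by
    have htr : (measureMap φ₀ ϑ o A).trace⁻¹ =
        (((measureMap φ₀ ϑ o A).trace.re⁻¹ : ℝ) : ℂ) := by
      rw [Complex.ofReal_inv, ofReal_re_trace (measureMap_posSemidef φ₀ ϑ o hA.1)]
    rw [probG, Finset.mul_sum]
    refine Finset.sum_congr rfl fun i _ => ?_
    rw [jump, htr, Matrix.smul_apply, smul_eq_mul, measureMap_apply, Complex.re_ofReal_mul,
      Complex.re_ofReal_mul, ← sq]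
    ring
  have hpos : 0 < amp φ₀ ϑ o n ^ 2 := by
    have := hadm.amp_ne_zero o n
    positivity
  have h2 : ∑ i, c i ^ 2 * a i = c n ^ 2 := by
    rw [hjump] at h'
    cases o
    · have ht : (measureMap φ₀ ϑ Outcome.g A).trace.re = c n := htr.trans h1
      rw [ht, inv_mul_eq_iff_eq_mul₀ hpos.ne', ← sq] at h'
      rw [← h']
      exact Finset.sum_congr rfl fun i _ => by simp only [hc]; ring
    · have ht : (measureMap φ₀ ϑ Outcome.e A).trace.re = 1 - c n := by
        rw [htr, ← h1, ← hsum, ← Finset.sum_sub_distrib]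
        exact Finset.sum_congr rfl fun i _ => by rw [he]; ring
      rw [he] at hpos
      rw [ht, inv_mul_eq_iff_eq_mul₀ hpos.ne'] at h'
      have : ∑ i, c i ^ 2 * a i =
          ∑ i, c i * a i - ∑ i, c i * (amp φ₀ ϑ Outcome.e i ^ 2 * a i) := by
        rw [← Finset.sum_sub_distrib]
        exact Finset.sum_congr rfl fun i _ => by rw [he]; ring
      rw [this, h1, h']
      ring
  have hvar : ∑ i, (c i - c n) ^ 2 * a i = 0 := by
    have : ∑ i, (c i - c n) ^ 2 * a i =
        ∑ i, c i ^ 2 * a i - 2 * c n * ∑ i, c i * a i + c n ^ 2 * ∑ i, a i := by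
      rw [Finset.mul_sum, Finset.mul_sum, ← Finset.sum_sub_distrib, ← Finset.sum_add_distrib]
      exact Finset.sum_congr rfl fun i _ => by ring
    rw [this, h1, h2, hsum]
    ring
  rw [Finset.sum_eq_zero_iff_of_nonneg fun i _ => mul_nonneg (sq_nonneg _) (ha0 i)] at hvar
  have hdiag : ∀ i, i ≠ n → A i i = 0 := by
    intro i hi
    have hne : c i - c n ≠ 0 := sub_ne_zero.2 fun h => hi (hadm.amp_sq_injective Outcome.g h)
    have hz : a i = 0 := (mul_eq_zero.1 (hvar i (Finset.mem_univ i))).resolve_left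
      (pow_ne_zero 2 hne)
    exact Complex.ext hz (Complex.nonneg_iff.1 hA.1.diag_nonneg).2.symm
  have hoff : ∀ i j, j ≠ n → A i j = 0 := fun i j hj =>
    apply_eq_zero_of_diag_eq_zero hA.1 (hdiag j hj) i
  ext i j
  rw [fock, Matrix.single_apply]
  by_cases hj : j = n
  · by_cases hi : i = n
    · subst hi hj
      have htr : ∑ i, A i i = 1 := hA.2
      rw [Finset.sum_eq_single j (fun b _ hb => hdiag b hb)
        (fun h => absurd (Finset.mem_univ j) h)] at htr
      simpa using htr
    · rw [if_neg fun h => hi h.1.symm, ← hA.1.isHermitian.apply i j, hoff j i hi, star_zero]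
  · rw [if_neg fun h => hj h.2.symm, hoff i j hj]

/-- At a state with vanishing controls, the spread measures how far the probability of the outcome
`g` is from its value at the target. -/
theorem spread_zero {A : Op N} (hA : A ∈ densityMatrices N) :
    spread φ₀ ϑ n 0 ((A, 0) : State N m) =
      fidelity n A * (amp φ₀ ϑ Outcome.g n ^ 2 - probG φ₀ ϑ A) := by
  have hA0 : displace (((A, 0) : State N m).2 (Fin.last m)) ((A, 0) : State N m).1 = A :=
    displace_zero A
  have hq : ∀ o, fidelity n (displace 0 (predOutcome φ₀ ϑ o ((A, 0) : State N m))) =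
      amp φ₀ ϑ o n ^ 2 * fidelity n A := by
    intro o
    have hinit : Fin.init (0 : Fin (m + 1) → ℂ) = (0 : Fin m → ℂ) := rfl
    rw [displace_zero, predOutcome, hinit, fidelity_foldr_kraus_zero, hA0, fidelity_eq,
      measureMap_apply, Complex.re_ofReal_mul, fidelity_eq, sq]
  have hp : outcomeProb φ₀ ϑ Outcome.g ((A, 0) : State N m) = probG φ₀ ϑ A := by
    rw [outcomeProb, hA0, re_trace_measureMap, probG]
  have hsum := outcomeProb_add φ₀ ϑ (χ := ((A, 0) : State N m)) hA
  have he := amp_g_sq_add_amp_e_sq φ₀ ϑ n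
  rw [spread, hq, hq]
  rw [hp] at hsum ⊢
  linear_combination (amp φ₀ ϑ Outcome.g n ^ 2 * fidelity n A) * hsum -
    probG φ₀ ϑ A * fidelity n A * he

theorem fidelity_pred_zero (A : Op N) :
    fidelity n (pred φ₀ ϑ ((A, 0) : State N m)) = fidelity n A :=
  fidelity_foldr_kraus_zero φ₀ ϑ n (m + 1) A

/-- The pending controls form a shift register, so they tend to `0` with the control. -/
theorem tendsto_register {x : ℕ → State N m} {α : ℕ → ℂ} {s : ℕ → Outcome}
    (hstep : ∀ k, x (k + 1) = step φ₀ ϑ (x k) (α k) (s k)) (hα : Tendsto α atTop (𝓝 0)) :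
    Tendsto (fun k => (x k).2) atTop (𝓝 0) := by
  rw [tendsto_pi_nhds]
  intro i
  induction i using Fin.induction with
  | zero =>
    rw [← tendsto_add_atTop_iff_nat 1]
    simpa [hstep, step] using hα
  | succ i ih =>
    rw [← tendsto_add_atTop_iff_nat 1]
    simpa [hstep, step, Fin.init] using ih

/-- A trajectory along which the predicted fidelity stays above `η` while the gradient and the
spread tend to `0` converges to the target: every limit point `A` of its first component has the
outcome statistics of the target, and so has the successor of `A`. -/
theorem tendsto_fock {x : ℕ → State N m} {α : ℕ → ℂ} {s : ℕ → Outcome}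
    (hadm : Admissible N φ₀ ϑ) (hη : 0 < η) (hmem : ∀ k, (x k).1 ∈ densityMatrices N)
    (hstep : ∀ k, x (k + 1) = step φ₀ ϑ (x k) (α k) (s k))
    (hV : ∀ᶠ k in atTop, η ≤ fidelity n (pred φ₀ ϑ (x k)))
    (hα : ∀ᶠ k in atTop, α k = gradientControl φ₀ ϑ n ε (x k))
    (hcontrol : Tendsto (fun k => gradientControl φ₀ ϑ n ε (x k)) atTop (𝓝 0))
    (hspread : Tendsto (fun k => spread φ₀ ϑ n (gradientControl φ₀ ϑ n ε (x k)) (x k)) atTop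
      (𝓝 0)) :
    Tendsto x atTop (𝓝 ((fock n, 0) : State N m)) := by
  have hreg : Tendsto (fun k => (x k).2) atTop (𝓝 0) :=
    tendsto_register hstep (hcontrol.congr' (hα.mono fun k hk => hk.symm))
  -- a limit along any ultrafilter has the outcome statistics of the target
  have hlim : ∀ (f : ℕ → ℕ) (l : Ultrafilter ℕ) (A : Op N), Tendsto f l atTop →
      Tendsto (fun k => (x (f k)).1) l (𝓝 A) → A ∈ densityMatrices N →
      probG φ₀ ϑ A = amp φ₀ ϑ Outcome.g n ^ 2 := by
    intro f l A hf hxA hA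
    have hx : Tendsto (fun k => x (f k)) l (𝓝 ((A, 0) : State N m)) :=
      hxA.prodMk_nhds (hreg.comp hf)
    have hVA : η ≤ fidelity n A := by
      rw [← fidelity_pred_zero (m := m) (φ₀ := φ₀) (ϑ := ϑ)]
      exact ge_of_tendsto ((continuous_fidelity_pred.tendsto _).comp hx) (hf.eventually hV)
    have hc0 : gradientControl φ₀ ϑ n ε ((A, 0) : State N m) = 0 :=
      tendsto_nhds_unique ((continuous_gradientControl.tendsto _).comp hx) (hcontrol.comp hf)
    have hs0 : spread φ₀ ϑ n (gradientControl φ₀ ϑ n ε ((A, 0) : State N m)) (A, 0) = 0 :=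
      tendsto_nhds_unique ((continuous_spread.tendsto _).comp hx) (hspread.comp hf)
    rw [hc0, spread_zero hA] at hs0
    have := (mul_eq_zero.1 hs0).resolve_left (hη.trans_le hVA).ne'
    linarith
  suffices hρ : Tendsto (fun k => (x k).1) atTop (𝓝 (fock n)) from hρ.prodMk_nhds hreg
  rw [tendsto_iff_ultrafilter]
  intro l hl
  obtain ⟨A, hA, hxA⟩ := (isCompact_densityMatrices N).ultrafilter_le_nhds
    (l.map fun k => (x k).1) (by
      rw [le_principal_iff]
      exact (Eventually.of_forall hmem : ∀ᶠ k in l, (x k).1 ∈ densityMatrices N))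
  have hxA : Tendsto (fun k => (x k).1) l (𝓝 A) := hxA
  obtain ⟨o, ho⟩ : ∃ o, ∀ᶠ k in l, s k = o := by
    have : ∀ᶠ k in l, s k = Outcome.g ∨ s k = Outcome.e :=
      Eventually.of_forall fun k => by cases s k <;> simp
    rcases Ultrafilter.eventually_or.1 this with h | h
    exacts [⟨_, h⟩, ⟨_, h⟩]
  have hpos := hadm.outcomeProb_pos o (χ := ((A, 0) : State N m)) hA
  have hA0 : displace (((A, 0) : State N m).2 (Fin.last m)) ((A, 0) : State N m).1 = A :=
    displace_zero A
  rw [outcomeProb, hA0] at hpos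
  have hmeas : Tendsto
      (fun k => measureMap φ₀ ϑ o (displace ((x k).2 (Fin.last m)) (x k).1)) l
      (𝓝 (measureMap φ₀ ϑ o A)) := by
    have h := (continuous_measureMap_displace φ₀ ϑ o).tendsto ((A, 0) : State N m)
    rw [hA0] at h
    exact h.comp (hxA.prodMk_nhds (hreg.mono_left hl))
  have hnext : Tendsto (fun k => (x (k + 1)).1) l (𝓝 (jump φ₀ ϑ o A)) := by
    have htr := ((continuous_id.matrix_trace).tendsto (measureMap φ₀ ϑ o A)).comp hmeas
    have hne : (measureMap φ₀ ϑ o A).trace ≠ 0 := fun h0 => by simp [h0] at hpos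
    refine ((htr.inv₀ hne).smul hmeas).congr' ?_
    filter_upwards [ho] with k hk
    rw [hstep, hk]
    rfl
  have hjump : jump φ₀ ϑ o A ∈ densityMatrices N :=
    inv_smul_mem_densityMatrices (measureMap_posSemidef φ₀ ϑ o hA.1) hpos
  have hfock := eq_fock_of_probG_eq hadm hA o (hlim id l A hl hxA hA)
    (hlim (fun k => k + 1) l _ ((tendsto_add_atTop_nat 1).mono_left hl) hnext hjump)
  rwa [← hfock]

end

end PhotonBox

end

theorem mainTheorem1 (N m : ℕ) (φ₀ ϑ : ℝ) (hadm : Admissible N φ₀ ϑ)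
    (nbar : Fin (N + 1)) (αbar : ℝ) (hαbar : 0 < αbar) :
    ∃ ε₀ > (0 : ℝ), ∃ η₀ > (0 : ℝ), ∀ ε : ℝ, 0 < ε → ε < ε₀ → ∀ η : ℝ, 0 < η → η < η₀ →
      ∀ u : State N m → ℂ, IsFeedbackLaw φ₀ ϑ nbar αbar ε η u →
      ∀ χ₀ : State N m, χ₀.1 ∈ densityMatrices N →
      ∀ (Ω : Type*) (mΩ : MeasurableSpace Ω) (μ : Measure Ω) (_ : IsProbabilityMeasure μ)
        (ℱ : Filtration ℕ mΩ) (χ : ℕ → Ω → State N m) (s : ℕ → Ω → Outcome),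
        IsClosedLoopChain φ₀ ϑ u χ₀ μ ℱ χ s →
        ∀ᵐ ω ∂μ, Tendsto (fun k => χ k ω) atTop (𝓝 ((fock nbar, 0) : State N m)) := by
  obtain ⟨ε₀, hε₀, hgain⟩ := exists_fidelity_displace_gradient_ge nbar
  obtain ⟨δ, hδ0, hδ⟩ := exists_le_fidelity_displace_of_max (m := m) hadm nbar hαbar
  refine ⟨ε₀, hε₀, min (δ / 2) (1 / 2), by positivity, ?_⟩
  intro ε hε hεε₀ η hη hηη₀ u hu χ₀ hχ₀ Ω mΩ μ _ ℱ χ s h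
  have hη1 : 2 * η ≤ δ := by linarith [hηη₀.trans_le (min_le_left _ _)]
  have hη2 : η ≤ 1 / 2 := hηη₀.le.trans (min_le_right _ _)
  have hmem := h.mem_densityMatrices hadm hχ₀
  have hdrift := h.ae_tendsto_drift (n := nbar) hadm hχ₀ hε hη hη2
    (fun χ hχ => lyapunov_add_drift_le hadm hη (hgain ε hε hεε₀) hε hχ)
    (fun χ hχ o => lyapunovNext_le hadm hδ hη hη1 hχ (hu χ hχ) o)
  filter_upwards [hdrift] with ω hω
  -- the drift equals `η` below the threshold, so the threshold is eventually exceeded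
  have hV : ∀ᶠ k in atTop, η ≤ fidelity nbar (pred φ₀ ϑ (χ k ω)) := by
    filter_upwards [hω.eventually_lt_const hη] with k hk
    by_contra hlt
    rw [drift, if_neg hlt] at hk
    exact lt_irrefl _ hk
  have hsum : Tendsto (fun k => ε * ‖fidelityGradient nbar (pred φ₀ ϑ (χ k ω))‖ ^ 2 +
      spread φ₀ ϑ nbar (gradientControl φ₀ ϑ nbar ε (χ k ω)) (χ k ω) ^ 2) atTop (𝓝 0) :=
    hω.congr' (hV.mono fun k hk => by rw [drift, if_pos hk])
  have hgrad :
      Tendsto (fun k => ε * ‖fidelityGradient nbar (pred φ₀ ϑ (χ k ω))‖ ^ 2) atTop (𝓝 0) :=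
    squeeze_zero (fun k => by positivity) (fun k => le_add_of_nonneg_right (sq_nonneg _)) hsum
  have hspread : Tendsto (fun k => spread φ₀ ϑ nbar (gradientControl φ₀ ϑ nbar ε (χ k ω))
      (χ k ω) ^ 2) atTop (𝓝 0) :=
    squeeze_zero (fun k => sq_nonneg _) (fun k => le_add_of_nonneg_left (by positivity)) hsum
  refine tendsto_fock (ε := ε) hadm hη (fun k => hmem k ω) (fun k => h.step_eq k ω) hV
    (hV.mono fun k hk => (hu _ (hmem k ω)).1 hk) ?_ ?_
  · rw [tendsto_zero_iff_norm_tendsto_zero]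
    have h1 := (hgrad.const_mul ε).sqrt
    rw [mul_zero, Real.sqrt_zero] at h1
    refine h1.congr fun k => ?_
    rw [gradientControl, norm_mul, Complex.norm_real, Real.norm_of_nonneg hε.le,
      ← Real.sqrt_sq (by positivity : 0 ≤ ε * ‖fidelityGradient nbar (pred φ₀ ϑ (χ k ω))‖)]
    ring_nf
  · have h1 := hspread.sqrt
    simp only [Real.sqrt_sq_eq_abs, Real.sqrt_zero] at h1
    exact (tendsto_zero_iff_abs_tendsto_zero _).2 h1
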